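/- Let $(Q,\mathfrak m,\mathsf k)$ be a commutative Noetherian local ring whose residue field $\mathsf k$ has characteristic $0$. Let $(f,g)$ be an exact pair of zero divisors in $Q$, i.e. $f,g\in Q$ are nonzero with $\mathrm{ann}_Q(f)=(g)$ and $\mathrm{ann}_Q(g)=(f)$, and set $R=Q/(f)$. Let $M$ and $N$ be finitely generated $R$-modules such that $gN=0$ and $M\otimes_Q N$ has finite length. For $A\in\{Q,R\}$ let $$\ell\mathrm{curv}_A(M,N)=\limsup_{n\to\infty}\sqrt[n]{\ell_A\bigl(\mathrm{Tor}_n^A(M,N)\bigr)}\in[0,\infty]$$ be the length curvature of the pair $(M,N)$ over $A$, that is, the reciprocal of the radius of convergence of $\sum_{n\ge0}\ell_A(\mathrm{Tor}_n^A(M,N))\,t^n$; here $\ell_A$ denotes length over $A$. If $\ell\mathrm{curv}_Q(M,N)\ge1$ and $\ell\mathrm{curv}_R(M,N)\ge1$, then $$\ell\mathrm{curv}_Q(M,N)=\ell\mathrm{curv}_R(M,N).$$ -/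

import Mathlib

open CategoryTheory
open scoped ENNReal TensorProduct

universe u

/-- `(f, g)` is an exact pair of zero divisors: `f` and `g` are nonzero, `ann(f) = (g)` and
`ann(g) = (f)`. -/
structure IsExactPairOfZeroDivisors {Q : Type u} [CommRing Q] (f g : Q) : Prop where
  left_ne_zero : f ≠ 0
  right_ne_zero : g ≠ 0
  annihilator_left : (Ideal.span {f}).annihilator = Ideal.span {g}
  annihilator_right : (Ideal.span {g}).annihilator = Ideal.span {f}

/-- The `A`-module `Tor_n^A(M, N)`: the `n`-th homology of `P ⊗ N`, where `P` is a projective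
resolution of `M`. -/
noncomputable abbrev torModule (A : Type u) [CommRing A] (M N : Type u)
    [AddCommGroup M] [Module A M] [AddCommGroup N] [Module A N] (n : ℕ) : ModuleCat.{u} A :=
  ((Tor' (ModuleCat.{u} A) n).obj (ModuleCat.of A M)).obj (ModuleCat.of A N)

/-- `β_n^A(M, N)`, the length of the `A`-module `Tor_n^A(M, N)`. -/
noncomputable def torLength (A : Type u) [CommRing A] (M N : Type u)
    [AddCommGroup M] [Module A M] [AddCommGroup N] [Module A N] (n : ℕ) : ℕ∞ :=
  Module.length A (torModule A M N n)

/-- The generalized Poincaré series `∑ β_n^A(M, N) t ^ n`. The coefficients are taken in `[0, ∞]`,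
so that no default value is used for modules of infinite length. -/
noncomputable def poincareSeries (A : Type u) [CommRing A] (M N : Type u)
    [AddCommGroup M] [Module A M] [AddCommGroup N] [Module A N] : PowerSeries ℝ≥0∞ :=
  PowerSeries.mk fun n => (torLength A M N n : ℝ≥0∞)

/-- The curvature `limsup_n (a_n) ^ (1 / n)`, an element of `[0, ∞]`, of a power series
`∑ a_n t ^ n` with nonnegative coefficients. -/
noncomputable def curvature (p : PowerSeries ℝ≥0∞) : ℝ≥0∞ :=
  Filter.limsup (fun n : ℕ => PowerSeries.coeff n p ^ (1 / (n : ℝ))) Filter.atTop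

/-- The length curvature of the pair `(M, N)` of `A`-modules. -/
noncomputable def lengthCurvature (A : Type u) [CommRing A] (M N : Type u)
    [AddCommGroup M] [Module A M] [AddCommGroup N] [Module A N] : ℝ≥0∞ :=
  curvature (poincareSeries A M N)

/-! ### Lengths of subquotients. -/

section RelativeLength

variable {A : Type*} [CommRing A]

/-! In residue characteristic 0 the Tate resolution of R over Q is Q[x, y] with x odd of degree 1, y
of degree 2, dx = f and dy = 2gx. Lift the differential of a graded free resolution of M over R to
an endomorphism `d` of a free Q-module, so that d² is divisible by f. Seek a = d + yα₁ + y²α₂ + …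
and b = β₀ + yβ₁ + … such that a + xb plus the Tate differential squares to zero; this means a² =
-fb and [a, b] = 2g ∂a/∂y. Exactness of (f, g) and division by 2(n + 1) give the coefficients one at
a time (`exists_seq_lax`). The resulting complex is a free resolution of M over Q
(`IsTwistedDifferential.exists_tateDiff_eq`).

Powers of y are never written. An element of total degree n is a pair (u, v), standing for u + xv;
the exponent of y at a basis vector t of u is (n - deg t)/2, so u lives in degrees n, n - 2, …, and
v in degrees n - 1, n - 3, …. Twice the exponent is n - deg t, which is why `degreeEnd` occurs in
the differential.

After tensoring with N, on which f and g vanish, a² = 0 and ab = ba. Let C be the complex of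
alternate parts with differential a. The complex computing Tor over Q is the cone of b, acting on C
with degree -2; the complex computing Tor over R is the quotient of C by a copy of C shifted by two.
The two long exact sequences bound the homology of C by partial sums of either family of Tor
lengths, and each Tor length by two homology lengths of C. Hence each family is at most twice the
partial sums of the other (`torLength_le_sum`).

For finite lengths (`torLength_ne_top`) such a bound gives one curvature at most the maximum of 1
and the other (`limsup_rpow_le_of_le_sum`). As both curvatures are at least 1, they agree. -/

theorem Module.length_le_add_of_ker_le_range {V₁ V₂ V₃ : Type*} [AddCommGroup V₁] [Module A V₁]
    [AddCommGroup V₂] [Module A V₂] [AddCommGroup V₃] [Module A V₃]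
    (φ : V₁ →ₗ[A] V₂) (ψ : V₂ →ₗ[A] V₃) (h : LinearMap.ker ψ ≤ LinearMap.range φ) :
    Module.length A V₂ ≤ Module.length A V₁ + Module.length A V₃ := by
  rw [Module.length_eq_add_of_exact (LinearMap.ker ψ).subtype ψ.rangeRestrict
    (LinearMap.ker ψ).injective_subtype ψ.surjective_rangeRestrict
    (by rw [LinearMap.exact_iff, LinearMap.ker_rangeRestrict, Submodule.range_subtype])]
  refine add_le_add ?_ (Module.length_le_of_injective _ (LinearMap.range ψ).injective_subtype)
  exact (Module.length_le_of_injective _ (Submodule.inclusion_injective h)).trans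
    (Module.length_le_of_surjective _ φ.surjective_rangeRestrict)

/-- The length of `K / (J ∩ K)`. -/
noncomputable def relLength {V : Type*} [AddCommGroup V] [Module A V] (K J : Submodule A V) : ℕ∞ :=
  Module.length A (K ⧸ J.comap K.subtype)

variable {V₁ V₂ V₃ : Type*} [AddCommGroup V₁] [Module A V₁]
    [AddCommGroup V₂] [Module A V₂] [AddCommGroup V₃] [Module A V₃]

/-- Exactness at the middle of three subquotients. It extracts one inequality from a long exact
sequence while only the representing elements are handled: the last hypothesis says that a class
killed by `ψ` comes from `K₁`. -/
theorem relLength_le_add {K₁ J₁ : Submodule A V₁} {K₂ J₂ : Submodule A V₂} {K₃ J₃ : Submodule A V₃}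
    (φ : V₁ →ₗ[A] V₂) (ψ : V₂ →ₗ[A] V₃)
    (hφK : ∀ x ∈ K₁, φ x ∈ K₂) (hφJ : ∀ x ∈ J₁, φ x ∈ J₂)
    (hψK : ∀ x ∈ K₂, ψ x ∈ K₃) (hψJ : ∀ x ∈ J₂, ψ x ∈ J₃)
    (h : ∀ x ∈ K₂, ψ x ∈ J₃ → ∃ y ∈ K₁, x - φ y ∈ J₂) :
    relLength K₂ J₂ ≤ relLength K₁ J₁ + relLength K₃ J₃ := by
  have hφ : J₁.comap K₁.subtype ≤ (J₂.comap K₂.subtype).comap (φ.restrict hφK) :=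
    fun x hx => hφJ _ hx
  have hψ : J₂.comap K₂.subtype ≤ (J₃.comap K₃.subtype).comap (ψ.restrict hψK) :=
    fun x hx => hψJ _ hx
  refine Module.length_le_add_of_ker_le_range (Submodule.mapQ _ _ _ hφ) (Submodule.mapQ _ _ _ hψ) ?_
  intro x hx
  obtain ⟨⟨x, hxK⟩, rfl⟩ := Submodule.mkQ_surjective _ x
  have hx' : ψ x ∈ J₃ := by
    rw [LinearMap.mem_ker, Submodule.mkQ_apply, Submodule.mapQ_apply,
      Submodule.Quotient.mk_eq_zero] at hx
    exact hx
  obtain ⟨y, hy, hxy⟩ := h x hxK hx'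
  refine ⟨Submodule.Quotient.mk ⟨y, hy⟩, ?_⟩
  rw [Submodule.mapQ_apply, Submodule.mkQ_apply, eq_comm, Submodule.Quotient.eq]
  exact hxy

theorem relLength_le {K₁ J₁ : Submodule A V₁} {K₂ J₂ : Submodule A V₂}
    (φ : V₁ →ₗ[A] V₂) (hφK : ∀ x ∈ K₁, φ x ∈ K₂) (hφJ : ∀ x ∈ J₁, φ x ∈ J₂)
    (h : ∀ x ∈ K₂, ∃ y ∈ K₁, x - φ y ∈ J₂) :
    relLength K₂ J₂ ≤ relLength K₁ J₁ := by
  have := relLength_le_add (J₁ := J₁) (J₂ := J₂) (K₃ := (⊥ : Submodule A V₂)) (J₃ := ⊥) φ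
    (0 : V₂ →ₗ[A] V₂) hφK hφJ (by simp) (by simp) (fun x hx _ => h x hx)
  have h0 : relLength (⊥ : Submodule A V₂) ⊥ = 0 := Module.length_eq_zero
  simpa [h0] using this

theorem relLength_eq_of_bijOn {K₁ J₁ : Submodule A V₁} {K₂ J₂ : Submodule A V₂}
    (φ : V₁ →ₗ[A] V₂) (ψ : V₂ →ₗ[A] V₁) (hφK : ∀ x ∈ K₁, φ x ∈ K₂) (hφJ : ∀ x ∈ J₁, φ x ∈ J₂)
    (hψK : ∀ x ∈ K₂, ψ x ∈ K₁) (hψJ : ∀ x ∈ J₂, ψ x ∈ J₁)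
    (h₁ : ∀ x ∈ K₁, x - ψ (φ x) ∈ J₁) (h₂ : ∀ x ∈ K₂, x - φ (ψ x) ∈ J₂) :
    relLength K₁ J₁ = relLength K₂ J₂ :=
  le_antisymm (relLength_le ψ hψK hψJ fun x hx => ⟨φ x, hφK x hx, h₁ x hx⟩)
    (relLength_le φ hφK hφJ fun x hx => ⟨ψ x, hψK x hx, h₂ x hx⟩)

/-- Allows homology of graded pieces to be computed inside the ambient module of all vectors. -/
theorem relLength_map {K J : Submodule A V₁} (φ : V₁ →ₗ[A] V₂) (hφ : Function.Injective φ) :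
    relLength (K.map φ) (J.map φ) = relLength K J := by
  refine le_antisymm (relLength_le φ (fun x hx => ⟨x, hx, rfl⟩) (fun x hx => ⟨x, hx, rfl⟩) ?_) ?_
  · rintro _ ⟨x, hx, rfl⟩
    exact ⟨x, hx, by simp⟩
  · refine Module.length_le_of_injective (Submodule.mapQ (J.comap K.subtype)
      ((J.map φ).comap (K.map φ).subtype) (φ.restrict fun x hx => ⟨x, hx, rfl⟩)
      (fun x hx => ⟨x, hx, rfl⟩)) ?_
    rw [← LinearMap.ker_eq_bot, Submodule.eq_bot_iff]
    intro x hx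
    obtain ⟨x, rfl⟩ := Submodule.mkQ_surjective _ x
    rw [LinearMap.mem_ker, Submodule.mkQ_apply] at hx
    obtain ⟨y, hy, hyx⟩ := (Submodule.Quotient.mk_eq_zero _).1 hx
    obtain rfl : y = x := hφ hyx
    exact (Submodule.Quotient.mk_eq_zero _).2 hy

end RelativeLength

/-! ### Tor lengths from explicit resolutions. -/

section Tor

variable {A : Type u} [CommRing A]

theorem ShortComplex.length_homology_eq (S : ShortComplex (ModuleCat.{u} A)) :
    Module.length A S.homology
      = relLength (LinearMap.ker S.g.hom) (LinearMap.range S.f.hom) := by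
  rw [S.moduleCatHomologyIso.toLinearEquiv.length_eq, relLength]
  refine (Submodule.quotEquivOfEq _ _ ?_).length_eq
  ext x
  simp only [LinearMap.mem_range, Submodule.mem_comap, Submodule.subtype_apply]
  exact exists_congr fun y => Subtype.ext_iff

variable {M N : Type u} [AddCommGroup M] [Module A M] [AddCommGroup N] [Module A N]
  (C : ℕ → Type u) [∀ n, AddCommGroup (C n)] [∀ n, Module A (C n)]
  (d : ∀ n, C (n + 1) →ₗ[A] C n) (ε : C 0 →ₗ[A] M)

/-- The chain complex of modules with the given differentials. -/
noncomputable abbrev moduleComplex (hd : ∀ n x, d n (d (n + 1) x) = 0) :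
    ChainComplex (ModuleCat.{u} A) ℕ :=
  ChainComplex.of (fun n => ModuleCat.of A (C n)) (fun n => ModuleCat.ofHom (d n))
    (fun n => by ext x; exact hd n x)

theorem moduleComplex_d (hd : ∀ n x, d n (d (n + 1) x) = 0) (n : ℕ) :
    (moduleComplex C d hd).d (n + 1) n = ModuleCat.ofHom (d n) :=
  ChainComplex.of_d (fun n => ModuleCat.of A (C n)) (fun n => ModuleCat.ofHom (d n)) n

theorem moduleComplex_d_apply (hd : ∀ n x, d n (d (n + 1) x) = 0) (n : ℕ) (x : C (n + 1)) :
    ((moduleComplex C d hd).d (n + 1) n).hom x = d n x := by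
  rw [moduleComplex_d]; rfl

/-- An exact sequence of projective modules as a projective resolution. -/
noncomputable def moduleResolution [∀ n, Module.Projective A (C n)]
    (hd : ∀ n x, d n (d (n + 1) x) = 0)
    (hdε : ∀ x, ε (d 0 x) = 0)
    (hex : ∀ n x, d n x = 0 → ∃ y, d (n + 1) y = x) (hexε : ∀ x, ε x = 0 → ∃ y, d 0 y = x)
    (hε : Function.Surjective ε) : ProjectiveResolution (ModuleCat.of A M) where
  complex := moduleComplex C d hd
  projective n := by dsimp; infer_instance
  π := (ChainComplex.toSingle₀Equiv _ _).symm ⟨ModuleCat.ofHom ε, by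
    rw [moduleComplex_d]; ext x; exact hdε x⟩
  quasiIso := ⟨fun n => by
    cases n with
    | zero =>
      rw [ChainComplex.quasiIsoAt₀_iff, ShortComplex.quasiIso_iff_of_zeros']
      · refine ⟨?_, ?_⟩
        · rw [ShortComplex.moduleCat_exact_iff]
          intro x hx
          replace hx : ε x = 0 := Eq.trans (congrArg (fun φ => φ.hom x)
              (ChainComplex.toSingle₀Equiv_symm_apply_f_zero (C := moduleComplex C d hd)
                (X := ModuleCat.of A M) (ModuleCat.ofHom ε) _).symm) hx
          obtain ⟨y, hy⟩ := hexε x hx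
          exact ⟨y, (moduleComplex_d_apply C d hd 0 y).trans hy⟩
        · rw [ModuleCat.epi_iff_surjective]
          intro m
          obtain ⟨x, hx⟩ := hε m
          refine ⟨x, Eq.trans ?_ hx⟩
          exact congrArg (fun φ => φ.hom x)
            (ChainComplex.toSingle₀Equiv_symm_apply_f_zero (C := moduleComplex C d hd)
              (X := ModuleCat.of A M) (ModuleCat.ofHom ε) _)
      all_goals rfl
    | succ n =>
      rw [quasiIsoAt_iff_exactAt']
      · rw [HomologicalComplex.exactAt_iff' _ (n + 1 + 1) (n + 1) n (by simp) (by simp),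
          ShortComplex.moduleCat_exact_iff]
        intro x hx
        obtain ⟨y, hy⟩ := hex n x ((moduleComplex_d_apply C d hd n x).symm.trans hx)
        exact ⟨y, (moduleComplex_d_apply C d hd (n + 1) y).trans hy⟩
      · apply ChainComplex.exactAt_succ_single_obj⟩

/-- The cycles of degree `n` in a sequence of linear maps. -/
def seqCycles {A : Type*} [CommRing A] {C : ℕ → Type*} [∀ n, AddCommGroup (C n)]
    [∀ n, Module A (C n)] (d : ∀ n, C (n + 1) →ₗ[A] C n) : ∀ n, Submodule A (C n)
  | 0 => ⊤
  | n + 1 => LinearMap.ker (d n)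

theorem relLength_seqCycles_eq {A : Type*} [CommRing A] {C C' : ℕ → Type*}
    [∀ n, AddCommGroup (C n)] [∀ n, Module A (C n)]
    [∀ n, AddCommGroup (C' n)] [∀ n, Module A (C' n)]
    (d : ∀ n, C (n + 1) →ₗ[A] C n) (d' : ∀ n, C' (n + 1) →ₗ[A] C' n) (e : ∀ n, C n ≃ₗ[A] C' n)
    (he : ∀ n x, d' n (e (n + 1) x) = e n (d n x)) (n : ℕ) :
    relLength (seqCycles d n) (LinearMap.range (d n)) =
      relLength (seqCycles d' n) (LinearMap.range (d' n)) := by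
  have he' : ∀ n x, d n ((e (n + 1)).symm x) = (e n).symm (d' n x) := fun n x => by
    rw [LinearEquiv.eq_symm_apply, ← he, LinearEquiv.apply_symm_apply]
  refine relLength_eq_of_bijOn (e n).toLinearMap (e n).symm.toLinearMap ?_ ?_ ?_ ?_ ?_ ?_
  · cases n with
    | zero => simp [seqCycles]
    | succ n => simp +contextual [seqCycles, he]
  · rintro _ ⟨x, rfl⟩
    exact ⟨e (n + 1) x, he n x⟩
  · cases n with
    | zero => simp [seqCycles]
    | succ n => simp +contextual [seqCycles, he']
  · rintro _ ⟨x, rfl⟩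
    exact ⟨(e (n + 1)).symm x, he' n x⟩
  · simp
  · simp

theorem length_homology_eq (K : ChainComplex (ModuleCat.{u} A) ℕ) (n : ℕ) :
    Module.length A (K.homology n) =
      relLength (seqCycles (C := fun n => K.X n) (fun n => (K.d (n + 1) n).hom) n)
        (LinearMap.range (K.d (n + 1) n).hom) := by
  cases n with
  | zero =>
    rw [(K.homologyIsoSc' 1 0 0 (by simp) (by simp)).toLinearEquiv.length_eq,
      ShortComplex.length_homology_eq]
    have : LinearMap.ker (K.sc' 1 0 0).g.hom = ⊤ := by
      have : (K.sc' 1 0 0).g = 0 := K.shape _ _ (by simp)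
      rw [this]
      exact LinearMap.ker_zero
    rw [this]
    rfl
  | succ n =>
    rw [(K.homologyIsoSc' (n + 1 + 1) (n + 1) n (by simp) (by simp)).toLinearEquiv.length_eq,
      ShortComplex.length_homology_eq]
    rfl

/-- If `C` is a projective resolution of `M` and the modules `C' n` with the maps `d' n` represent
`C n ⊗ N`, then the length of `Tor` is that of the homology of `C'`. -/
theorem torLength_eq_relLength [∀ n, Module.Projective A (C n)]
    (hd : ∀ n x, d n (d (n + 1) x) = 0)
    (hdε : ∀ x, ε (d 0 x) = 0)
    (hex : ∀ n x, d n x = 0 → ∃ y, d (n + 1) y = x) (hexε : ∀ x, ε x = 0 → ∃ y, d 0 y = x)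
    (hε : Function.Surjective ε)
    {C' : ℕ → Type*} [∀ n, AddCommGroup (C' n)] [∀ n, Module A (C' n)]
    (d' : ∀ n, C' (n + 1) →ₗ[A] C' n) (e : ∀ n, (C n ⊗[A] N) ≃ₗ[A] C' n)
    (he : ∀ n (x : C (n + 1)) (y : N), d' n (e (n + 1) (x ⊗ₜ y)) = e n (d n x ⊗ₜ y)) (n : ℕ) :
    torLength A M N n = relLength (seqCycles d' n) (LinearMap.range (d' n)) := by
  let P := moduleResolution C d ε hd hdε hex hexε hε
  have h := (P.isoLeftDerivedObj
    ((MonoidalCategory.tensoringRight (ModuleCat.{u} A)).obj (ModuleCat.of A N)) n)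
  have h1 := h.toLinearEquiv.length_eq
  refine h1.trans ?_
  refine (length_homology_eq _ n).trans ?_
  have key : ∀ n (x : C (n + 1) ⊗[A] N), d' n (e (n + 1) x) = e n ((d n).rTensor N x) := by
    intro n x
    induction x with
    | zero => simp
    | tmul x y => simpa using he n x y
    | add x y hx hy => simp only [map_add, hx, hy]
  have hD : ∀ n, (((((MonoidalCategory.tensoringRight (ModuleCat.{u} A)).obj
      (ModuleCat.of A N)).mapHomologicalComplex _).obj P.complex).d (n + 1) n).hom =
      ((d n).rTensor N : C (n + 1) ⊗[A] N →ₗ[A] C n ⊗[A] N) := by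
    intro n
    have : P.complex.d (n + 1) n = ModuleCat.ofHom (d n) := moduleComplex_d C d hd n
    change (MonoidalCategory.whiskerRight (P.complex.d (n + 1) n) (ModuleCat.of A N)).hom = _
    rw [this]
    rfl
  refine relLength_seqCycles_eq _ d' e (fun n x => ?_) n
  rw [hD]
  exact key n x

end Tor

/-! ### Recursive construction of sequences; antidiagonal sums. -/

section Sequences

open Finset.HasAntidiagonal (antidiagonal)
open Finset.HasAntidiagonal.antidiagonal (fst_le snd_le)

/-- Course-of-values dependent choice: since the condition at n sees only the terms up to n, later
choices cannot spoil earlier ones. It produces both the twisting coefficients and the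
null-homotopies. -/
theorem exists_seq_of_exists_update {X : Type*} [Nonempty X] (Good : (ℕ → X) → ℕ → Prop)
    (hcongr : ∀ c c' n, (∀ m ≤ n, c m = c' m) → Good c n → Good c' n)
    (step : ∀ c n, (∀ m < n, Good c m) → ∃ x, Good (Function.update c n x) n) :
    ∃ c, ∀ n, Good c n := by
  choose x hx using step
  let next : ∀ n, {c : ℕ → X // ∀ m < n, Good c m} → {c : ℕ → X // ∀ m < n + 1, Good c m} :=
    fun n c => ⟨Function.update c.1 n (x c.1 n c.2), fun m hm => by
      rcases Nat.lt_succ_iff_lt_or_eq.1 hm with h | rfl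
      · refine hcongr c.1 _ m (fun k hk => ?_) (c.2 m h)
        rw [Function.update_of_ne (by omega)]
      · exact hx _ _ _⟩
  let F : ∀ n, {c : ℕ → X // ∀ m < n, Good c m} :=
    fun n => Nat.rec ⟨fun _ => Classical.arbitrary X, by simp⟩ next n
  have hF : ∀ n m, m < n → (F n).1 m = (F (m + 1)).1 m := by
    intro n
    induction n with
    | zero => simp
    | succ n ih =>
      intro m hm
      rcases Nat.lt_succ_iff_lt_or_eq.1 hm with h | rfl
      · rw [← ih m h]
        exact Function.update_of_ne (by omega) _ _
      · rfl
  refine ⟨fun n => (F (n + 1)).1 n, fun n => hcongr (F (n + 1)).1 _ n (fun m hm => ?_)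
    ((F (n + 1)).2 n (by omega))⟩
  exact hF _ _ (by omega)

theorem PowerSeries.coeff_mul_congr_left {E : Type*} [Ring E] {p p' : PowerSeries E}
    (q : PowerSeries E) {m : ℕ} (h : ∀ i ≤ m, coeff i p = coeff i p') :
    coeff m (p * q) = coeff m (p' * q) := by
  rw [coeff_mul, coeff_mul]
  refine Finset.sum_congr rfl fun x hx => ?_
  rw [h x.1 (fst_le hx)]

theorem PowerSeries.coeff_mul_congr_right {E : Type*} [Ring E] {p p' : PowerSeries E}
    (q : PowerSeries E) {m : ℕ} (h : ∀ i ≤ m, coeff i p = coeff i p') :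
    coeff m (q * p) = coeff m (q * p') := by
  rw [coeff_mul, coeff_mul]
  refine Finset.sum_congr rfl fun x hx => ?_
  rw [h x.2 (snd_le hx)]

theorem Finset.sum_range_sum_range_eq_sum_antidiagonal {X : Type*} [AddCommMonoid X] (L : ℕ)
    (h : ℕ → ℕ → X) (h0 : ∀ i j, L ≤ i + j → h i j = 0) :
    ∑ i ∈ range L, ∑ j ∈ range L, h i j = ∑ n ∈ range L, ∑ x ∈ antidiagonal n, h x.1 x.2 := by
  simp_rw [Nat.sum_antidiagonal_eq_sum_range_succ_mk]
  rw [sum_range_diag_flip]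
  refine sum_congr rfl fun i _ => ?_
  refine (sum_subset (range_subset_range.2 (by omega)) fun j _ hj => h0 i j ?_).symm
  rw [mem_range] at hj
  omega

end Sequences

/-! ### The recursion for the twisting power series. -/

section Lax

open Finset.HasAntidiagonal (antidiagonal)
open Finset.HasAntidiagonal.antidiagonal (fst_le snd_le)

variable {A E : Type*} [CommRing A] [Ring E] [Algebra A E]

/-- Solving `a ^ 2 = - f b` and `a b - b a = 2 g a'` for power series `a`, `b` coefficient by
coefficient, in a graded algebra where multiplication by `f` and `g` is exact. -/
theorem exists_seq_lax (G : ℕ → Submodule A E)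
    (hmul : ∀ i j x y, x ∈ G i → y ∈ G j → x * y ∈ G (i + j))
    (f g : A) (hunit : ∀ n : ℕ, n ≠ 0 → IsUnit (n : A))
    (hf : ∀ i, ∀ x ∈ G i, f • x = 0 → ∃ y ∈ G i, x = g • y)
    (hg : ∀ i, ∀ x ∈ G i, g • x = 0 → ∃ y ∈ G i, x = f • y)
    (d : E) (hd : d ∈ G 1) (hdd : ∃ b ∈ G 2, d * d = -(f • b)) :
    ∃ a b : ℕ → E, a 0 = d ∧ (∀ n, a n ∈ G (2 * n + 1)) ∧ (∀ n, b n ∈ G (2 * n + 2)) ∧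
      (∀ n, ∑ x ∈ antidiagonal n, a x.1 * a x.2 = -(f • b n)) ∧
      (∀ n, ∑ x ∈ antidiagonal n, a x.1 * b x.2 - ∑ x ∈ antidiagonal n, b x.1 * a x.2 =
        (2 * (n + 1) : A) • g • a (n + 1)) := by
  let Good : (ℕ → E × E) → ℕ → Prop := fun c n =>
    (n = 0 → (c n).1 = d) ∧ (c n).1 ∈ G (2 * n + 1) ∧ (c n).2 ∈ G (2 * n + 2) ∧
    (∑ x ∈ antidiagonal n, (c x.1).1 * (c x.2).1 = -(f • (c n).2)) ∧
    ∀ m, n = m + 1 → ∑ x ∈ antidiagonal m, ((c x.1).1 * (c x.2).2 - (c x.1).2 * (c x.2).1) =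
        (2 * (m + 1) : A) • g • (c n).1
  obtain ⟨c, hc⟩ : ∃ c, ∀ n, Good c n := by
    refine exists_seq_of_exists_update Good ?_ ?_
    · intro c c' n h ⟨h0, h1, h2, h3, h4⟩
      have hn := h n le_rfl
      refine ⟨hn ▸ h0, hn ▸ h1, hn ▸ h2, ?_, ?_⟩
      · rw [← hn, ← h3]
        refine Finset.sum_congr rfl fun x hx => ?_
        rw [h _ (fst_le hx), h _ (snd_le hx)]
      · intro m hm
        rw [← hn, ← h4 m hm]
        refine Finset.sum_congr rfl fun x hx => ?_
        have h1 := fst_le hx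
        have h2 := snd_le hx
        rw [h x.1 (by omega), h x.2 (by omega)]
    · intro c n hc
      cases n with
      | zero =>
        obtain ⟨b, hb, hdb⟩ := hdd
        refine ⟨(d, b), ?_⟩
        simp [Good, hd, hb, hdb]
      | succ m =>
        -- The terms beyond m are not yet constructed; only coefficients up to m of these series and
        -- their products are used.
        let a : PowerSeries E := PowerSeries.mk fun i => (c i).1
        let b : PowerSeries E := PowerSeries.mk fun i => (c i).2
        let fb : PowerSeries E := PowerSeries.mk fun i => -(f • (c i).2)
        have haa : ∀ i ≤ m, PowerSeries.coeff i (a * a) = PowerSeries.coeff i fb := by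
          intro i hi
          rw [PowerSeries.coeff_mul]
          simpa [a, fb] using (hc i (by omega)).2.2.2.1
        set S : ℕ → E := fun k => PowerSeries.coeff k (a * b - b * a) with hS
        have hSc : ∀ k, S k = ∑ x ∈ antidiagonal k,
            ((c x.1).1 * (c x.2).2 - (c x.1).2 * (c x.2).1) := by
          intro k
          simp [hS, PowerSeries.coeff_mul, a, b, Finset.sum_sub_distrib]
        have hSG : S m ∈ G (2 * (m + 1) + 1) := by
          rw [hSc]
          refine Submodule.sum_mem _ fun x hx => ?_
          have hx1 := fst_le hx
          have hx2 := snd_le hx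
          have hx' := Finset.HasAntidiagonal.mem_antidiagonal.1 hx
          obtain ⟨-, h1, h2, -⟩ := hc x.1 (by omega)
          obtain ⟨-, h3, h4, -⟩ := hc x.2 (by omega)
          refine Submodule.sub_mem _ ?_ ?_
          · have := hmul _ _ _ _ h1 h4
            rwa [show 2 * x.1 + 1 + (2 * x.2 + 2) = 2 * (m + 1) + 1 by omega] at this
          · have := hmul _ _ _ _ h2 h3
            rwa [show 2 * x.1 + 2 + (2 * x.2 + 1) = 2 * (m + 1) + 1 by omega] at this
        -- Up to order m, fb = -a², and a commutes with a²; so f annihilates the commutator.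
        have hfS : f • S m = 0 := by
          have h1 : f • PowerSeries.coeff m (a * b) = - PowerSeries.coeff m (a * (a * a)) := by
            rw [PowerSeries.coeff_mul_congr_right a haa, PowerSeries.coeff_mul,
              PowerSeries.coeff_mul, Finset.smul_sum]
            simp [fb, b]
          have h2 : f • PowerSeries.coeff m (b * a) = - PowerSeries.coeff m ((a * a) * a) := by
            rw [PowerSeries.coeff_mul_congr_left a haa, PowerSeries.coeff_mul,
              PowerSeries.coeff_mul, Finset.smul_sum]
            simp [fb, b]
          simp only [hS, map_sub, smul_sub, h1, h2, mul_assoc, sub_self]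
        obtain ⟨y, hy, hSy⟩ := hf _ _ hSG hfS
        obtain ⟨w, hw⟩ := hunit (2 * (m + 1)) (by omega)
        push_cast at hw
        -- Dividing by 2(m + 1) is where invertibility of nonzero integers is needed.
        let α : E := (↑w⁻¹ : A) • y
        have hα : (2 * (m + 1) : A) • g • α = S m := by
          rw [← hw, hSy, smul_comm g, smul_smul]
          simp
        have hαG : α ∈ G (2 * (m + 1) + 1) := Submodule.smul_mem _ _ hy
        let a' : ℕ → E := Function.update (fun i => (c i).1) (m + 1) α
        have ha'S : ∀ k ≤ m, (2 * (k + 1) : A) • g • a' (k + 1) = S k := by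
          intro k hk
          rcases hk.lt_or_eq with hk | rfl
          · rw [hSc, (hc (k + 1) (by omega)).2.2.2.2 k rfl]
            simp only [a']
            rw [Function.update_of_ne (by omega)]
          · simp only [a']
            rw [Function.update_self, hα]
        have ha'G : ∀ k ≤ m + 1, a' k ∈ G (2 * k + 1) := by
          intro k hk
          rcases hk.lt_or_eq with hk | rfl
          · simp only [a']
            rw [Function.update_of_ne (by omega)]
            exact (hc k hk).2.1
          · simp only [a']
            rw [Function.update_self]
            exact hαG
        have ha'a : ∀ k ≤ m, a' k = PowerSeries.coeff k a := by
          intro k hk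
          simp only [a', a, PowerSeries.coeff_mk]
          rw [Function.update_of_ne (by omega)]
        let T : E := ∑ x ∈ antidiagonal (m + 1), a' x.1 * a' x.2
        have hTG : T ∈ G (2 * (m + 1) + 2) := by
          refine Submodule.sum_mem _ fun x hx => ?_
          have hx' := Finset.HasAntidiagonal.mem_antidiagonal.1 hx
          have := hmul _ _ _ _ (ha'G x.1 (fst_le hx))
            (ha'G x.2 (snd_le hx))
          rwa [show 2 * x.1 + 1 + (2 * x.2 + 1) = 2 * (m + 1) + 2 by omega] at this
        -- Splitting 2(m + 1) as 2i + 2j along the antidiagonal turns the left side into a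
        -- coefficient of [a, b]a + a[a, b] = [a², b], which vanishes because a² = -fb up to order
        -- m.
        have hT : (2 * (m + 1) : A) • g • T = 0 := by
          have h1 : (2 * (m + 1) : A) • g • T =
              ∑ x ∈ antidiagonal (m + 1), ((2 * (x.1 : A)) • g • a' x.1) * a' x.2 +
              ∑ x ∈ antidiagonal (m + 1), a' x.1 * ((2 * (x.2 : A)) • g • a' x.2) := by
            rw [← Finset.sum_add_distrib, Finset.smul_sum, Finset.smul_sum]
            refine Finset.sum_congr rfl fun x hx => ?_
            have hx' : (x.1 : A) + x.2 = m + 1 := by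
              rw [← Nat.cast_add, Finset.HasAntidiagonal.mem_antidiagonal.1 hx]
              push_cast; rfl
            rw [smul_mul_assoc, smul_mul_assoc, mul_smul_comm, mul_smul_comm, ← add_smul,
              ← mul_add, hx']
          rw [h1, Finset.Nat.sum_antidiagonal_succ, Finset.Nat.sum_antidiagonal_succ']
          have h2 : ∑ x ∈ antidiagonal m,
              ((2 * ((x.1 + 1 : ℕ) : A)) • g • a' (x.1 + 1)) * a' x.2 =
              PowerSeries.coeff m ((a * b - b * a) * a) := by
            rw [PowerSeries.coeff_mul]
            refine Finset.sum_congr rfl fun x hx => ?_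
            push_cast
            rw [ha'S _ (fst_le hx), ha'a _ (snd_le hx)]
          have h3 : ∑ x ∈ antidiagonal m,
              a' x.1 * ((2 * ((x.2 + 1 : ℕ) : A)) • g • a' (x.2 + 1)) =
              PowerSeries.coeff m (a * (a * b - b * a)) := by
            rw [PowerSeries.coeff_mul]
            refine Finset.sum_congr rfl fun x hx => ?_
            push_cast
            rw [ha'S _ (snd_le hx), ha'a _ (fst_le hx)]
          simp only [Nat.cast_zero, mul_zero, zero_smul, zero_mul, zero_add]
          rw [h2, h3, ← map_add,
            show (a * b - b * a) * a + a * (a * b - b * a) = (a * a) * b - b * (a * a) by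
              noncomm_ring, map_sub, PowerSeries.coeff_mul_congr_left b haa,
            PowerSeries.coeff_mul_congr_right b haa, PowerSeries.coeff_mul, PowerSeries.coeff_mul]
          simp [fb, b]
        have hgT : g • T = 0 := by
          rw [← hw] at hT
          exact (w.isUnit.smul_eq_zero).1 hT
        obtain ⟨z, hz, hTz⟩ := hg _ _ hTG hgT
        have hfst : ∀ k, (Function.update c (m + 1) (α, -z) k).1 = a' k := by
          intro k
          by_cases hk : k = m + 1
          · subst hk; simp [a']
          · simp [a', Function.update_of_ne hk]
        refine ⟨(α, -z), by simp, by simpa using hαG, by simpa using hz, ?_, ?_⟩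
        · simp only [hfst, Function.update_self]
          rw [smul_neg, neg_neg]
          exact hTz
        · intro k hk
          obtain rfl : m = k := by omega
          rw [Function.update_self, hα, hSc]
          refine Finset.sum_congr rfl fun x hx => ?_
          have h1 := fst_le hx
          have h2 := snd_le hx
          rw [Function.update_of_ne (by omega), Function.update_of_ne (by omega)]
  refine ⟨fun n => (c n).1, fun n => (c n).2, (hc 0).1 rfl, fun n => (hc n).2.1,
    fun n => (hc n).2.2.1, fun n => (hc n).2.2.2.1, fun n => ?_⟩
  rw [← Finset.sum_sub_distrib]
  exact (hc (n + 1)).2.2.2.2 n rfl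

end Lax

/-! ### Endomorphisms of a graded free module. -/

section HomogeneousEndomorphisms

open Finset.HasAntidiagonal (antidiagonal)
open Finset.HasAntidiagonal.antidiagonal (fst_le snd_le)

variable {A I : Type*} [CommRing A]

/-- The endomorphisms of a free module whose matrix is supported on the relation `ρ`. -/
def supportedEnd (A : Type*) [CommRing A] (ρ : I → I → Prop) :
    Submodule A (Module.End A (I →₀ A)) where
  carrier := {h | ∀ s, h (Finsupp.single s 1) ∈ Finsupp.supported A A {t | ρ s t}}
  add_mem' h h' s := Submodule.add_mem _ (h s) (h' s)
  zero_mem' _ := Submodule.zero_mem _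
  smul_mem' c _ h s := Submodule.smul_mem _ c (h s)

theorem supportedEnd_mono {ρ ρ' : I → I → Prop} (h : ∀ s t, ρ s t → ρ' s t) :
    supportedEnd A ρ ≤ supportedEnd A ρ' :=
  fun _ hx s => Finsupp.supported_mono (h s) (hx s)

theorem supportedEnd_apply_mem {ρ : I → I → Prop} {h : Module.End A (I →₀ A)}
    (hh : h ∈ supportedEnd A ρ) {S T : Set I} (hST : ∀ s ∈ S, ∀ t, ρ s t → t ∈ T)
    {v : I →₀ A} (hv : v ∈ Finsupp.supported A A S) : h v ∈ Finsupp.supported A A T := by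
  rw [Finsupp.supported_eq_span_single] at hv
  induction hv using Submodule.span_induction with
  | mem x hx =>
    obtain ⟨s, hs, rfl⟩ := hx
    exact Finsupp.supported_mono (hST s hs) (hh s)
  | zero => simp
  | add x y _ _ hx hy => rw [map_add]; exact Submodule.add_mem _ hx hy
  | smul c x _ hx => rw [map_smul]; exact Submodule.smul_mem _ c hx

theorem supportedEnd_mul {ρ σ τ : I → I → Prop} (hτ : ∀ s t r, σ s t → ρ t r → τ s r)
    {h h' : Module.End A (I →₀ A)} (hh : h ∈ supportedEnd A ρ) (hh' : h' ∈ supportedEnd A σ) :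
    h * h' ∈ supportedEnd A τ :=
  fun s => supportedEnd_apply_mem hh (fun t ht r hr => hτ s t r ht hr) (hh' s)

theorem Finsupp.exists_eq_smul_of_forall {g : A} {S : Set I} {v : I →₀ A}
    (hv : v ∈ Finsupp.supported A A S) (h : ∀ s, ∃ e, v s = g * e) :
    ∃ w ∈ Finsupp.supported A A S, v = g • w := by
  -- Choosing zero quotients for zero entries keeps the support finite and inside `S`.
  have : ∀ s, ∃ e, v s = g * e ∧ (v s = 0 → e = 0) := by
    intro s
    by_cases h0 : v s = 0
    · exact ⟨0, by simp [h0], fun _ => rfl⟩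
    · obtain ⟨e, he⟩ := h s
      exact ⟨e, he, fun h => absurd h h0⟩
  choose e he he0 using this
  refine ⟨Finsupp.onFinset v.support e fun s hs => ?_, ?_, ?_⟩
  · rw [Finsupp.mem_support_iff]
    exact fun h => hs (he0 s h)
  · rw [Finsupp.mem_supported'] at hv ⊢
    intro s hs
    exact he0 s (hv s hs)
  · ext s
    simpa using he s

theorem supportedEnd_exists_eq_smul_of_forall {g : A} {ρ : I → I → Prop}
    {h : Module.End A (I →₀ A)} (hh : h ∈ supportedEnd A ρ)
    (hg : ∀ s t, ∃ e, h (Finsupp.single s 1) t = g * e) : ∃ k ∈ supportedEnd A ρ, h = g • k := by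
  have : ∀ s, ∃ w ∈ Finsupp.supported A A {t | ρ s t}, h (Finsupp.single s 1) = g • w := fun s =>
    Finsupp.exists_eq_smul_of_forall (hh s) (hg s)
  choose w hw hw' using this
  refine ⟨Finsupp.linearCombination A w, fun s => ?_, ?_⟩
  · simpa using hw s
  · refine Finsupp.lhom_ext' fun s => LinearMap.ext_ring ?_
    simpa using hw' s

theorem supportedEnd_exists_smul_eq {f g : A}
    (hfg : ∀ c : A, f * c = 0 → ∃ e, c = g * e) {ρ : I → I → Prop} {h : Module.End A (I →₀ A)}
    (hh : h ∈ supportedEnd A ρ) (h0 : f • h = 0) : ∃ k ∈ supportedEnd A ρ, h = g • k :=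
  supportedEnd_exists_eq_smul_of_forall hh fun s t => hfg _ <| by
    simpa using DFunLike.congr_fun (LinearMap.congr_fun h0 (Finsupp.single s 1)) t

variable (deg : I → ℕ)

/-- The endomorphism multiplying each basis vector by its degree. -/
noncomputable def degreeEnd (A : Type*) [CommRing A] (deg : I → ℕ) : Module.End A (I →₀ A) :=
  Finsupp.linearCombination A fun s => Finsupp.single s (deg s : A)

theorem degreeEnd_apply (v : I →₀ A) (t : I) : degreeEnd A deg v t = deg t * v t := by
  classical
  rw [degreeEnd, Finsupp.linearCombination_apply, Finsupp.sum_apply, Finsupp.sum,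
    Finset.sum_eq_single t]
  · simp [mul_comm]
  · intro s _ hs
    simp [Finsupp.single_eq_of_ne hs.symm]
  · intro ht
    simp [Finsupp.notMem_support_iff.1 ht]

/-- The sum of a sequence of endomorphisms, the `i`-th of which lowers degrees by at least `i`. -/
noncomputable def locallyFiniteSum (h : ℕ → Module.End A (I →₀ A)) : Module.End A (I →₀ A) :=
  Finsupp.linearCombination A fun s =>
    ∑ i ∈ Finset.range (deg s + 1), h i (Finsupp.single s 1)

variable {deg}

/-- The endomorphisms lowering degrees by exactly `k`. -/
abbrev homogeneousEnd (A : Type*) [CommRing A] (deg : I → ℕ) (k : ℕ) :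
    Submodule A (Module.End A (I →₀ A)) :=
  supportedEnd A fun s t => deg t + k = deg s

/-- The endomorphisms lowering degrees by at least `k`. -/
abbrev loweringEnd (A : Type*) [CommRing A] (deg : I → ℕ) (k : ℕ) :
    Submodule A (Module.End A (I →₀ A)) :=
  supportedEnd A fun s t => deg t + k ≤ deg s

theorem homogeneousEnd_le_loweringEnd {j k : ℕ} (h : j ≤ k) :
    homogeneousEnd A deg k ≤ loweringEnd A deg j :=
  supportedEnd_mono fun _ _ h => by omega

theorem loweringEnd_apply_single {h : Module.End A (I →₀ A)} {k : ℕ}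
    (hh : h ∈ loweringEnd A deg k) {s : I} (hs : deg s < k) : h (Finsupp.single s 1) = 0 := by
  have : {t | deg t + k ≤ deg s} = (∅ : Set I) := by
    ext t
    simp only [Set.mem_ofPred_eq, Set.mem_empty_iff_false, iff_false]
    omega
  have h0 := hh s
  rw [this, Finsupp.supported_empty] at h0
  exact (Submodule.mem_bot A).1 h0

/-- The i-th term kills basis vectors of degree below i, so any cutoff beyond `deg s` gives the same
sum. -/
theorem locallyFiniteSum_single {h : ℕ → Module.End A (I →₀ A)}
    (hh : ∀ i, h i ∈ loweringEnd A deg i) {s : I} {L : ℕ} (hL : deg s < L) :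
    locallyFiniteSum deg h (Finsupp.single s 1) =
      ∑ i ∈ Finset.range L, h i (Finsupp.single s 1) := by
  rw [locallyFiniteSum, Finsupp.linearCombination_single, one_smul]
  refine Finset.sum_subset (Finset.range_subset_range.2 hL) fun i _ hi => ?_
  rw [Finset.mem_range] at hi
  exact loweringEnd_apply_single (hh i) (by omega)

theorem locallyFiniteSum_apply {h : ℕ → Module.End A (I →₀ A)}
    (hh : ∀ i, h i ∈ loweringEnd A deg i) {L : ℕ} {v : I →₀ A}
    (hv : v ∈ Finsupp.supported A A {s | deg s < L}) :
    locallyFiniteSum deg h v = ∑ i ∈ Finset.range L, h i v := by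
  rw [Finsupp.supported_eq_span_single] at hv
  induction hv using Submodule.span_induction with
  | mem x hx =>
    obtain ⟨s, hs, rfl⟩ := hx
    exact locallyFiniteSum_single hh hs
  | zero => simp
  | add x y _ _ hx hy => simp [hx, hy, Finset.sum_add_distrib]
  | smul c x _ hx => simp [hx, Finset.smul_sum]

/-- A product `h i * h' j` lowers degrees by at least i + j. On each basis vector the double sum is
therefore finite and regroups as a Cauchy product, which turns power series identities into
identities of endomorphisms. -/
theorem locallyFiniteSum_mul {h h' : ℕ → Module.End A (I →₀ A)}
    (hh : ∀ i, h i ∈ loweringEnd A deg i) (hh' : ∀ i, h' i ∈ loweringEnd A deg i) :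
    locallyFiniteSum deg h * locallyFiniteSum deg h' =
      locallyFiniteSum deg fun n => ∑ x ∈ antidiagonal n, h x.1 * h' x.2 := by
  have hmul : ∀ i j, h i * h' j ∈ loweringEnd A deg (i + j) := fun i j =>
    supportedEnd_mul (fun s t r h1 h2 => by omega) (hh i) (hh' j)
  have hconv : ∀ n, ∑ x ∈ antidiagonal n, h x.1 * h' x.2 ∈ loweringEnd A deg n := fun n =>
    Submodule.sum_mem _ fun x hx => by
      have := hmul x.1 x.2
      rwa [Finset.HasAntidiagonal.mem_antidiagonal.1 hx] at this
  refine Finsupp.lhom_ext' fun s => LinearMap.ext_ring ?_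
  simp only [LinearMap.coe_comp, Function.comp_apply, Finsupp.lsingle_apply, Module.End.mul_apply]
  rw [locallyFiniteSum_single hh' (Nat.lt_succ_self (deg s)),
    locallyFiniteSum_single hconv (Nat.lt_succ_self (deg s)),
    locallyFiniteSum_apply (L := (deg s).succ) hh
      (Submodule.sum_mem _ fun i _ => Finsupp.supported_mono (fun t ht => ?_) (hh' i s))]
  · simp only [map_sum, LinearMap.sum_apply]
    refine Finset.sum_range_sum_range_eq_sum_antidiagonal _
      (fun i j => h i (h' j (Finsupp.single s 1))) fun i j hij => ?_
    exact loweringEnd_apply_single (hmul i j) (by omega)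
  · simp only [Set.mem_ofPred_eq] at ht ⊢
    omega

theorem locallyFiniteSum_sub (h h' : ℕ → Module.End A (I →₀ A)) :
    locallyFiniteSum deg h - locallyFiniteSum deg h' =
      locallyFiniteSum deg fun n => h n - h' n := by
  refine Finsupp.lhom_ext' fun s => LinearMap.ext_ring ?_
  simp [locallyFiniteSum]

theorem neg_smul_locallyFiniteSum (c : A) (h : ℕ → Module.End A (I →₀ A)) :
    -(c • locallyFiniteSum deg h) = locallyFiniteSum deg fun n => -(c • h n) := by
  refine Finsupp.lhom_ext' fun s => LinearMap.ext_ring ?_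
  simp [locallyFiniteSum, Finset.smul_sum]

theorem locallyFiniteSum_mem {h : ℕ → Module.End A (I →₀ A)} {ρ : I → I → Prop}
    (hh : ∀ i, h i ∈ supportedEnd A ρ) : locallyFiniteSum deg h ∈ supportedEnd A ρ := by
  intro s
  rw [locallyFiniteSum, Finsupp.linearCombination_single, one_smul]
  exact Submodule.sum_mem _ fun i _ => hh i s

/-- This commutator replaces differentiation in y: for the coefficient of yⁱ in `a`, which has k =
2i + 1, subtracting the endomorphism itself leaves the factor 2i. -/
theorem degreeEnd_mul_sub_mul {h : Module.End A (I →₀ A)} {k : ℕ}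
    (hh : h ∈ homogeneousEnd A deg k) :
    h * degreeEnd A deg - degreeEnd A deg * h = (k : A) • h := by
  refine Finsupp.lhom_ext' fun s => LinearMap.ext_ring ?_
  ext t
  have h1 : degreeEnd A deg (Finsupp.single s 1) = (deg s : A) • Finsupp.single s 1 := by
    simp [degreeEnd]
  simp only [LinearMap.coe_comp, Function.comp_apply, Finsupp.lsingle_apply, Module.End.mul_apply,
    LinearMap.sub_apply, LinearMap.smul_apply, Finsupp.sub_apply, Finsupp.smul_apply,
    degreeEnd_apply, h1, map_smul, smul_eq_mul]
  by_cases ht : deg t + k = deg s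
  · rw [← ht]
    push_cast
    ring
  · rw [(Finsupp.mem_supported' _ _).1 (hh s) t ht]
    simp

/-- A square-zero-modulo-`f` endomorphism of degree `-1` extends to a solution `a`, `b` of the
equations expressing that `a + x b` is a twisted differential over the Tate resolution of
`A / f`. -/
theorem exists_twisted_differential {f g : A} (hunit : ∀ n : ℕ, n ≠ 0 → IsUnit (n : A))
    (hf : ∀ c : A, f * c = 0 → ∃ e, c = g * e) (hg : ∀ c : A, g * c = 0 → ∃ e, c = f * e)
    (d : Module.End A (I →₀ A)) (hd : d ∈ homogeneousEnd A deg 1)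
    (hdd : ∃ b ∈ homogeneousEnd A deg 2, d * d = -(f • b)) :
    ∃ a b : Module.End A (I →₀ A),
      a - d ∈ supportedEnd A (fun s t => deg t + 3 ≤ deg s ∧ Odd (deg t + deg s)) ∧
      b ∈ supportedEnd A (fun s t => deg t + 2 ≤ deg s ∧ Even (deg t + deg s)) ∧
      a * a = -(f • b) ∧
      a * b - b * a = g • (a * degreeEnd A deg - degreeEnd A deg * a - a) := by
  have hmul : ∀ i j (x y : Module.End A (I →₀ A)), x ∈ homogeneousEnd A deg i →
      y ∈ homogeneousEnd A deg j → x * y ∈ homogeneousEnd A deg (i + j) :=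
    fun i j x y hx hy => supportedEnd_mul (fun s t r h1 h2 => by omega) hx hy
  have hf' : ∀ i, ∀ x ∈ homogeneousEnd A deg i, f • x = 0 →
      ∃ y ∈ homogeneousEnd A deg i, x = g • y :=
    fun i x hx h => supportedEnd_exists_smul_eq hf hx h
  have hg' : ∀ i, ∀ x ∈ homogeneousEnd A deg i, g • x = 0 →
      ∃ y ∈ homogeneousEnd A deg i, x = f • y :=
    fun i x hx h => supportedEnd_exists_smul_eq hg hx h
  obtain ⟨α, β, h0, hα, hβ, hαα, hαβ⟩ :=
    exists_seq_lax (homogeneousEnd A deg) hmul f g hunit hf' hg' d hd hdd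
  have hα' : ∀ i, α i ∈ loweringEnd A deg i := fun i =>
    homogeneousEnd_le_loweringEnd (by omega) (hα i)
  have hβ' : ∀ i, β i ∈ loweringEnd A deg i := fun i =>
    homogeneousEnd_le_loweringEnd (by omega) (hβ i)
  refine ⟨locallyFiniteSum deg α, locallyFiniteSum deg β, ?_, ?_, ?_, ?_⟩
  · intro s
    rw [LinearMap.sub_apply, locallyFiniteSum_single hα' (Nat.lt_succ_self (deg s)),
      Finset.sum_range_succ', h0, add_sub_cancel_right]
    refine Submodule.sum_mem _ fun i _ => Finsupp.supported_mono (fun t ht => ?_) (hα (i + 1) s)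
    simp only [Set.mem_ofPred_eq] at ht ⊢
    exact ⟨by omega, by rw [Nat.odd_iff]; omega⟩
  · refine locallyFiniteSum_mem fun i => supportedEnd_mono (fun s t ht => ?_) (hβ i)
    exact ⟨by omega, by rw [Nat.even_iff]; omega⟩
  · rw [locallyFiniteSum_mul hα' hα', neg_smul_locallyFiniteSum]
    congr 1
    funext n
    exact hαα n
  · rw [locallyFiniteSum_mul hα' hβ', locallyFiniteSum_mul hβ' hα']
    rw [locallyFiniteSum_sub]
    simp only [hαβ]
    refine Finsupp.lhom_ext' fun s => LinearMap.ext_ring ?_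
    simp only [LinearMap.coe_comp, Function.comp_apply, Finsupp.lsingle_apply]
    have hs : α (deg s + 1) (Finsupp.single s 1) = 0 :=
      loweringEnd_apply_single (hα' _) (by omega)
    have hdeg : degreeEnd A deg (Finsupp.single s 1) = (deg s : A) • Finsupp.single s 1 := by
      simp [degreeEnd]
    have key : ∀ i, α i (degreeEnd A deg (Finsupp.single s 1)) -
        degreeEnd A deg (α i (Finsupp.single s 1)) - α i (Finsupp.single s 1) =
        (2 * i : A) • α i (Finsupp.single s 1) := by
      intro i
      have := LinearMap.congr_fun (degreeEnd_mul_sub_mul (hα i)) (Finsupp.single s 1)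
      simp only [Module.End.mul_apply, LinearMap.sub_apply, LinearMap.smul_apply] at this
      rw [this]
      push_cast
      rw [add_smul, one_smul, add_sub_cancel_right]
    rw [locallyFiniteSum, Finsupp.linearCombination_single, one_smul]
    simp only [Module.End.mul_apply, LinearMap.sub_apply, LinearMap.smul_apply]
    -- One term more than necessary is summed: the term i = 0 has factor 2i = 0, and dropping it
    -- shifts the index to the range of the left side.
    have h2 : locallyFiniteSum deg α (degreeEnd A deg (Finsupp.single s 1)) -
        degreeEnd A deg (locallyFiniteSum deg α (Finsupp.single s 1)) -
        locallyFiniteSum deg α (Finsupp.single s 1) =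
        ∑ i ∈ Finset.range (deg s + 1),
          (2 * (i + 1 : ℕ) : A) • α (i + 1) (Finsupp.single s 1) := by
      rw [hdeg, map_smul, locallyFiniteSum_single hα' (show deg s < deg s + 1 + 1 by omega),
        map_sum, Finset.smul_sum, ← Finset.sum_sub_distrib, ← Finset.sum_sub_distrib]
      rw [Finset.sum_congr rfl (g := fun i : ℕ => (2 * i : A) • α i (Finsupp.single s 1))
        fun i _ => by rw [← key i, hdeg, map_smul], Finset.sum_range_succ']
      simp
    rw [h2, Finset.smul_sum]
    refine Finset.sum_congr rfl fun i _ => ?_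
    push_cast
    rw [smul_comm]

end HomogeneousEndomorphisms

/-! ### Matrices over the ring acting on vectors with entries in N. -/

section BaseChange

variable {A I : Type*} [CommRing A] (N : Type*) [AddCommGroup N] [Module A N]

variable (A I) in
/-- The tensor product of a free module with `N`. -/
noncomputable def freeTensorEquiv : (I →₀ A) ⊗[A] N ≃ₗ[A] I →₀ N :=
  letI := Classical.decEq I
  TensorProduct.finsuppScalarLeft A N I

/-- The action of a matrix with coefficients in `A` on vectors with entries in `N`. -/
noncomputable def coeffEnd : Module.End A (I →₀ A) →ₐ[A] Module.End A (I →₀ N) :=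
  ((freeTensorEquiv A I N).conjAlgEquiv A).toAlgHom.comp
    (Module.End.rTensorAlgHom A (I →₀ A) N)

variable {N}

theorem freeTensorEquiv_tmul_apply (v : I →₀ A) (x : N) (t : I) :
    freeTensorEquiv A I N (v ⊗ₜ x) t = v t • x := by
  classical
  exact TensorProduct.finsuppScalarLeft_apply_tmul_apply v x t

theorem freeTensorEquiv_single_tmul (s : I) (x : N) :
    freeTensorEquiv A I N (Finsupp.single s 1 ⊗ₜ x) = Finsupp.single s x := by
  classical
  ext t
  rw [freeTensorEquiv_tmul_apply, Finsupp.single_apply, Finsupp.single_apply]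
  split_ifs <;> simp

theorem coeffEnd_freeTensorEquiv (h : Module.End A (I →₀ A)) (x : (I →₀ A) ⊗[A] N) :
    coeffEnd N h (freeTensorEquiv A I N x) = freeTensorEquiv A I N (h.rTensor N x) := by
  simp only [coeffEnd, AlgHom.comp_apply]
  change freeTensorEquiv A I N (h.rTensor N ((freeTensorEquiv A I N).symm _)) = _
  rw [LinearEquiv.symm_apply_apply]

theorem freeTensorEquiv_tmul_mem_supported {S : Set I} {v : I →₀ A}
    (hv : v ∈ Finsupp.supported A A S) (x : N) :
    freeTensorEquiv A I N (v ⊗ₜ x) ∈ Finsupp.supported N A S := by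
  rw [Finsupp.mem_supported'] at hv ⊢
  intro s hs
  rw [freeTensorEquiv_tmul_apply, hv s hs, zero_smul]

theorem coeffEnd_apply_mem {ρ : I → I → Prop} {h : Module.End A (I →₀ A)}
    (hh : h ∈ supportedEnd A ρ) {S T : Set I} (hST : ∀ s ∈ S, ∀ t, ρ s t → t ∈ T)
    {v : I →₀ N} (hv : v ∈ Finsupp.supported N A S) : coeffEnd N h v ∈ Finsupp.supported N A T := by
  rw [← v.sum_single, Finsupp.sum, map_sum]
  refine Submodule.sum_mem _ fun s hs => ?_
  rw [← freeTensorEquiv_single_tmul (A := A), coeffEnd_freeTensorEquiv, LinearMap.rTensor_tmul]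
  exact freeTensorEquiv_tmul_mem_supported
    (Finsupp.supported_mono (fun t ht => hST s (hv hs) t ht) (hh s)) _

end BaseChange

/-! ### Homogeneous and alternate parts, and leading components. -/

section Filtration

variable {A I : Type*} [CommRing A] {N : Type*} [AddCommGroup N] [Module A N]

variable (A N) in
/-- The vectors supported in degree `n`. -/
def homogeneousPart (deg : I → ℕ) (n : ℤ) : Submodule A (I →₀ N) :=
  Finsupp.supported N A {t | (deg t : ℤ) = n}

variable (A N) in
/-- The vectors supported in the degrees `n, n - 2, n - 4, …`. -/
def alternatePart (deg : I → ℕ) (n : ℤ) : Submodule A (I →₀ N) :=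
  Finsupp.supported N A {t | (deg t : ℤ) ≤ n ∧ Even (n - deg t)}

variable {deg : I → ℕ}

theorem homogeneousPart_le_alternatePart (n : ℤ) :
    homogeneousPart A N deg n ≤ alternatePart A N deg n :=
  Finsupp.supported_mono fun t ht => by
    simp only [Set.mem_ofPred_eq] at ht ⊢
    simp [ht]

theorem alternatePart_sub_two_le (n : ℤ) :
    alternatePart A N deg (n - 2) ≤ alternatePart A N deg n :=
  Finsupp.supported_mono fun t ⟨h1, h2⟩ => ⟨by omega, by
    rw [Int.even_iff] at h2 ⊢; omega⟩

theorem alternatePart_of_neg {n : ℤ} (hn : n < 0) : alternatePart A N deg n = ⊥ := by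
  rw [eq_bot_iff]
  intro v hv
  rw [alternatePart, Finsupp.mem_supported'] at hv
  rw [Submodule.mem_bot]
  ext t
  exact hv t fun h => by have := h.1; omega

theorem eq_zero_of_mem_alternatePart {n : ℤ} (hn : n < 0) {v : I →₀ N}
    (hv : v ∈ alternatePart A N deg n) : v = 0 := by
  rwa [alternatePart_of_neg hn, Submodule.mem_bot] at hv

variable (A N) in
/-- The projection onto the part of degree `n`. -/
noncomputable def homogeneousProj (deg : I → ℕ) (n : ℤ) : Module.End A (I →₀ N) :=
  (Finsupp.supported N A {t | (deg t : ℤ) = n}).subtype ∘ₗ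
    Finsupp.restrictDom N A {t | (deg t : ℤ) = n}

theorem homogeneousProj_mem (n : ℤ) (v : I →₀ N) :
    homogeneousProj A N deg n v ∈ homogeneousPart A N deg n :=
  Subtype.mem _

theorem homogeneousProj_apply (n : ℤ) (v : I →₀ N) (t : I) :
    homogeneousProj A N deg n v t = if (deg t : ℤ) = n then v t else 0 := by
  simp [homogeneousProj, Finsupp.restrictDom_apply, Finsupp.filter_apply]

theorem homogeneousProj_of_mem {n : ℤ} {v : I →₀ N} (hv : v ∈ homogeneousPart A N deg n) :
    homogeneousProj A N deg n v = v := by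
  rw [homogeneousPart, Finsupp.mem_supported'] at hv
  ext t
  rw [homogeneousProj_apply]
  split_ifs with h
  · rfl
  · exact (hv t h).symm

theorem homogeneousProj_eq_zero {n : ℤ} {S : Set I} (hS : ∀ t ∈ S, (deg t : ℤ) ≠ n) {v : I →₀ N}
    (hv : v ∈ Finsupp.supported N A S) : homogeneousProj A N deg n v = 0 := by
  rw [Finsupp.mem_supported'] at hv
  ext t
  rw [homogeneousProj_apply]
  split_ifs with h
  · exact hv t fun ht => hS t ht h
  · rfl

theorem homogeneousProj_of_mem_sub_two {n : ℤ} {v : I →₀ N}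
    (hv : v ∈ alternatePart A N deg (n - 2)) : homogeneousProj A N deg n v = 0 :=
  homogeneousProj_eq_zero (fun t ht => by have := ht.1; omega) hv

theorem sub_homogeneousProj_mem {n : ℤ} {v : I →₀ N} (hv : v ∈ alternatePart A N deg n) :
    v - homogeneousProj A N deg n v ∈ alternatePart A N deg (n - 2) := by
  rw [alternatePart, Finsupp.mem_supported'] at hv ⊢
  intro t ht
  rw [Finsupp.sub_apply, homogeneousProj_apply]
  split_ifs with h
  · exact sub_self _
  · rw [sub_zero]
    refine hv t fun ⟨h1, h2⟩ => ht ⟨?_, ?_⟩ <;> rw [Int.even_iff] at * <;> omega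

end Filtration

/-! ### Length inequalities for the twisted complex with coefficients in N. -/

section TwistedPair

variable {A I : Type*} [CommRing A] {N : Type*} [AddCommGroup N] [Module A N]

/-- Commuting endomorphisms `a`, `b` of degrees at most `-1` and `-2` with `a ^ 2 = 0`, where `d` is
the leading part of `a`. -/
structure IsTwistedPair (deg : I → ℕ) (d a b : Module.End A (I →₀ N)) : Prop where
  d_mem : ∀ n, ∀ v ∈ homogeneousPart A N deg n, d v ∈ homogeneousPart A N deg (n - 1)
  sub_mem : ∀ n, ∀ v ∈ alternatePart A N deg n, a v - d v ∈ alternatePart A N deg (n - 3)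
  a_mem : ∀ n, ∀ v ∈ alternatePart A N deg n, a v ∈ alternatePart A N deg (n - 1)
  b_mem : ∀ n, ∀ v ∈ alternatePart A N deg n, b v ∈ alternatePart A N deg (n - 2)
  a_a : ∀ v, a (a v) = 0
  a_b : ∀ v, a (b v) = b (a v)

/-- The differential `(u, v) ↦ (a u, b u - a v)`. -/
noncomputable def twistedDiff (a b : Module.End A (I →₀ N)) : Module.End A ((I →₀ N) × (I →₀ N)) :=
  (a ∘ₗ LinearMap.fst A _ _).prod (b ∘ₗ LinearMap.fst A _ _ - a ∘ₗ LinearMap.snd A _ _)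

variable (deg : I → ℕ) (d a b : Module.End A (I →₀ N))

/-- The length of the homology of the homogeneous parts with differential `d`. -/
noncomputable def homogeneousLength (n : ℤ) : ℕ∞ :=
  relLength (homogeneousPart A N deg n ⊓ LinearMap.ker d) ((homogeneousPart A N deg (n + 1)).map d)

/-- The length of the homology of the alternate parts with differential `a`. -/
noncomputable def alternateLength (n : ℤ) : ℕ∞ :=
  relLength (alternatePart A N deg n ⊓ LinearMap.ker a) ((alternatePart A N deg (n + 1)).map a)

/-- The length of the homology of pairs of vectors with differential `twistedDiff a b`. -/
noncomputable def twistedLength (n : ℤ) : ℕ∞ :=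
  relLength
    ((alternatePart A N deg n).prod (alternatePart A N deg (n - 1)) ⊓
      LinearMap.ker (twistedDiff a b))
    (((alternatePart A N deg (n + 1)).prod (alternatePart A N deg n)).map (twistedDiff a b))

variable {deg d a b}

theorem alternateLength_of_neg {n : ℤ} (hn : n < 0) : alternateLength deg a n = 0 := by
  rw [alternateLength, alternatePart_of_neg hn, bot_inf_eq]
  exact Module.length_eq_zero

theorem mem_alternatePart_of_eq {m n : ℤ} {v : I →₀ N} (hv : v ∈ alternatePart A N deg m)
    (h : m = n) : v ∈ alternatePart A N deg n := h ▸ hv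

/-- Taking leading components is a chain map from (alternate parts, `a`) to (homogeneous parts,
`d`), since everything else in `a v` lies in degree at most n - 2. -/
theorem homogeneousProj_eq_of_sub_mem
    (hd : ∀ n, ∀ v ∈ homogeneousPart A N deg n, d v ∈ homogeneousPart A N deg (n - 1))
    (hs : ∀ n, ∀ v ∈ alternatePart A N deg n, a v - d v ∈ alternatePart A N deg (n - 3))
    (ha : ∀ n, ∀ v ∈ alternatePart A N deg n, a v ∈ alternatePart A N deg (n - 1))
    {n : ℤ} {v : I →₀ N} (hv : v ∈ alternatePart A N deg (n + 1)) :
    homogeneousProj A N deg n (a v) = d (homogeneousProj A N deg (n + 1) v) := by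
  have h0 := homogeneousProj_mem (A := A) (deg := deg) (n + 1) v
  have h1 := sub_homogeneousProj_mem hv
  set v₀ := homogeneousProj A N deg (n + 1) v
  have e : a v = d v₀ + ((a v₀ - d v₀) + a (v - v₀)) := by
    rw [map_sub]; abel
  have h2 : (a v₀ - d v₀) + a (v - v₀) ∈ alternatePart A N deg (n - 2) :=
    Submodule.add_mem _
      (mem_alternatePart_of_eq (hs _ _ (homogeneousPart_le_alternatePart _ h0)) (by ring))
      (mem_alternatePart_of_eq (ha _ _ h1) (by ring))
  have h3 := hd _ _ h0
  rw [add_sub_cancel_right] at h3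
  rw [e, map_add, homogeneousProj_of_mem h3, homogeneousProj_of_mem_sub_two h2, add_zero]

namespace IsTwistedPair

variable (h : IsTwistedPair deg d a b)
include h

theorem homogeneousProj_a {n : ℤ} {v : I →₀ N} (hv : v ∈ alternatePart A N deg (n + 1)) :
    homogeneousProj A N deg n (a v) = d (homogeneousProj A N deg (n + 1) v) :=
  homogeneousProj_eq_of_sub_mem h.d_mem h.sub_mem h.a_mem hv

theorem d_homogeneousProj {n : ℤ} {v : I →₀ N} (hv : v ∈ alternatePart A N deg n)
    (hav : a v = 0) : d (homogeneousProj A N deg n v) = 0 := by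
  have := h.homogeneousProj_a (n := n - 1) (v := v) (mem_alternatePart_of_eq hv (by ring))
  rw [hav, map_zero, sub_add_cancel] at this
  exact this.symm

/-- Exactness at the quotient in the long exact sequence of the alternate complex, its two-step
shift and the homogeneous complex. On a d-cycle v the connecting map is v ↦ a v, which equals a v -
d v and so drops to degree n - 3. -/
theorem homogeneousLength_le (n : ℤ) :
    homogeneousLength deg d n ≤ alternateLength deg a n + alternateLength deg a (n - 3) := by
  refine relLength_le_add (homogeneousProj A N deg n) a ?_ ?_ ?_ ?_ ?_
  · rintro v ⟨hv, hav⟩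
    exact ⟨homogeneousProj_mem n v, h.d_homogeneousProj hv hav⟩
  · rintro _ ⟨v, hv, rfl⟩
    exact ⟨_, homogeneousProj_mem (n + 1) v, (h.homogeneousProj_a hv).symm⟩
  · rintro v ⟨hv, hdv⟩
    refine ⟨?_, h.a_a v⟩
    have := h.sub_mem _ _ (homogeneousPart_le_alternatePart _ hv)
    rwa [LinearMap.mem_ker.1 hdv, sub_zero] at this
  · rintro _ ⟨v, hv, rfl⟩
    -- As a² = 0, this element has image a(d v), and it lies in the smaller part needed for a
    -- boundary there.
    refine ⟨-(a v - d v), Submodule.neg_mem _ (mem_alternatePart_of_eq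
      (h.sub_mem _ _ (homogeneousPart_le_alternatePart _ hv)) (by ring)), ?_⟩
    rw [map_neg, map_sub, h.a_a, zero_sub, neg_neg]
  · rintro v ⟨hv, hdv⟩ ⟨y, hy, hay⟩
    replace hy : y ∈ alternatePart A N deg (n - 2) := mem_alternatePart_of_eq hy (by ring)
    refine ⟨v - y, ⟨Submodule.sub_mem _ (homogeneousPart_le_alternatePart _ hv)
      (alternatePart_sub_two_le n hy), ?_⟩, ?_⟩
    · rw [SetLike.mem_coe, LinearMap.mem_ker, map_sub, hay, sub_self]
    · rw [map_sub, homogeneousProj_of_mem hv, homogeneousProj_of_mem_sub_two hy, sub_zero, sub_self]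
      exact Submodule.zero_mem _

/-- Exactness at the middle of the same sequence: a cycle whose leading component is d y becomes,
after subtracting a y, a cycle without leading component. -/
theorem alternateLength_le_homogeneousLength (n : ℤ) :
    alternateLength deg a n ≤ alternateLength deg a (n - 2) + homogeneousLength deg d n := by
  refine relLength_le_add LinearMap.id (homogeneousProj A N deg n) ?_ ?_ ?_ ?_ ?_
  · rintro v ⟨hv, hav⟩
    exact ⟨alternatePart_sub_two_le n hv, hav⟩
  · rintro _ ⟨v, hv, rfl⟩
    exact ⟨v, alternatePart_sub_two_le _ (mem_alternatePart_of_eq hv (by ring)), rfl⟩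
  · rintro v ⟨hv, hav⟩
    exact ⟨homogeneousProj_mem n v, h.d_homogeneousProj hv hav⟩
  · rintro _ ⟨v, hv, rfl⟩
    exact ⟨_, homogeneousProj_mem (n + 1) v, (h.homogeneousProj_a hv).symm⟩
  · rintro v ⟨hv, hav⟩ ⟨y, hy, hyv⟩
    have hy' := homogeneousPart_le_alternatePart _ hy
    refine ⟨v - a y, ⟨?_, ?_⟩, ⟨y, hy', by simp⟩⟩
    · have e : v - a y = (v - homogeneousProj A N deg n v) - (a y - d y) := by rw [hyv]; abel
      rw [e]
      exact Submodule.sub_mem _ (sub_homogeneousProj_mem hv)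
        (mem_alternatePart_of_eq (h.sub_mem _ _ hy') (by ring))
    · rw [SetLike.mem_coe, LinearMap.mem_ker, map_sub, h.a_a, sub_zero, LinearMap.mem_ker.1 hav]

/-- The long exact sequence of the cone of `b`: a cycle u with b u = a v lifts to the twisted cycle
(u, v). -/
theorem alternateLength_le_twistedLength (n : ℤ) :
    alternateLength deg a n ≤ twistedLength deg a b n + alternateLength deg a (n - 2) := by
  refine relLength_le_add (LinearMap.fst A _ _) b ?_ ?_ ?_ ?_ ?_
  · rintro ⟨u, v⟩ ⟨hv, hav⟩
    exact ⟨hv.1, congrArg Prod.fst hav⟩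
  · rintro _ ⟨⟨u, v⟩, hv, rfl⟩
    exact ⟨u, hv.1, rfl⟩
  · rintro v ⟨hv, hav⟩
    refine ⟨h.b_mem _ _ hv, ?_⟩
    rw [SetLike.mem_coe, LinearMap.mem_ker, h.a_b, LinearMap.mem_ker.1 hav, map_zero]
  · rintro _ ⟨v, hv, rfl⟩
    exact ⟨b v, mem_alternatePart_of_eq (h.b_mem _ _ hv) (by ring), h.a_b v⟩
  · rintro u ⟨hu, hau⟩ ⟨v, hv, hvu⟩
    refine ⟨(u, v), ⟨⟨hu, mem_alternatePart_of_eq hv (by ring)⟩, ?_⟩, by simp⟩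
    rw [SetLike.mem_coe, LinearMap.mem_ker] at hau ⊢
    simp [twistedDiff, hau, hvu]

/-- The cone again, with second coordinates as subcomplex and first coordinates as quotient. If u =
a y, subtracting the differential of (y, 0) from (u, v) leaves (0, v - b y). -/
theorem twistedLength_le_alternateLength (n : ℤ) :
    twistedLength deg a b n ≤ alternateLength deg a (n - 1) + alternateLength deg a n := by
  refine relLength_le_add (LinearMap.inr A _ _) (LinearMap.fst A _ _) ?_ ?_ ?_ ?_ ?_
  · rintro v ⟨hv, hav⟩
    refine ⟨⟨Submodule.zero_mem _, hv⟩, ?_⟩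
    rw [SetLike.mem_coe, LinearMap.mem_ker] at hav ⊢
    simp [twistedDiff, hav]
  · rintro _ ⟨v, hv, rfl⟩
    -- The second coordinate carries the differential -a, whence the sign.
    refine ⟨(0, -v), ⟨Submodule.zero_mem _, Submodule.neg_mem _
      (mem_alternatePart_of_eq hv (by ring))⟩, ?_⟩
    simp [twistedDiff]
  · rintro ⟨u, v⟩ ⟨hv, hav⟩
    exact ⟨hv.1, congrArg Prod.fst hav⟩
  · rintro _ ⟨⟨u, v⟩, hv, rfl⟩
    exact ⟨u, hv.1, rfl⟩
  · rintro ⟨u, v⟩ ⟨hv, hav⟩ ⟨y, hy, hyu⟩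
    have hyu : a y = u := hyu
    have h2 : b u - a v = 0 := congrArg Prod.snd hav
    refine ⟨v - b y, ⟨Submodule.sub_mem _ hv.2 (mem_alternatePart_of_eq (h.b_mem _ _ hy) (by ring)),
      ?_⟩, ⟨(y, 0), ⟨hy, Submodule.zero_mem _⟩, ?_⟩⟩
    · rw [SetLike.mem_coe, LinearMap.mem_ker, map_sub, h.a_b, hyu, ← neg_sub, h2, neg_zero]
    · simp [twistedDiff, hyu]

end IsTwistedPair

/-- Unrolls a recursion of step two. The bound covers every k ≤ n because the two applications also
need indices n - 1 and n - 3. -/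
theorem le_sum_range_of_le_add_sub_two {w : ℤ → ℕ∞} {c : ℕ → ℕ∞} (hneg : ∀ n < 0, w n = 0)
    (hw : ∀ n : ℕ, w n ≤ c n + w (n - 2)) (n : ℕ) :
    ∀ k : ℤ, k ≤ n → w k ≤ ∑ i ∈ Finset.range (n + 1), c i := by
  have main : ∀ n : ℕ, w n ≤ ∑ i ∈ Finset.range (n + 1), c i := by
    intro n
    induction n using Nat.strong_induction_on with
    | _ n ih =>
      rw [Finset.sum_range_succ, add_comm]
      refine (hw n).trans (add_le_add_right ?_ _)
      match n, ih with
      | 0, _ => simp [hneg]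
      | 1, _ => simp [hneg]
      | n + 2, ih =>
        have h2 := ih n (by omega)
        rw [show ((n + 2 : ℕ) : ℤ) - 2 = n by push_cast; ring]
        exact h2.trans (Finset.sum_le_sum_of_subset (Finset.range_subset_range.2 (by omega)))
  intro k hk
  rcases lt_or_ge k 0 with h0 | h0
  · simp [hneg k h0]
  · lift k to ℕ using h0
    exact (main k).trans (Finset.sum_le_sum_of_subset (Finset.range_subset_range.2 (by omega)))

theorem IsTwistedPair.homogeneousLength_le_sum (h : IsTwistedPair deg d a b) (n : ℕ) :
    homogeneousLength deg d n ≤ 2 * ∑ i ∈ Finset.range (n + 1), twistedLength deg a b i := by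
  have := le_sum_range_of_le_add_sub_two (w := alternateLength deg a)
    (c := fun i => twistedLength deg a b i)
    (fun n hn => alternateLength_of_neg hn) (fun n => h.alternateLength_le_twistedLength n) n
  rw [two_mul]
  exact (h.homogeneousLength_le n).trans (add_le_add (this _ le_rfl) (this _ (by omega)))

theorem IsTwistedPair.twistedLength_le_sum (h : IsTwistedPair deg d a b) (n : ℕ) :
    twistedLength deg a b n ≤ 2 * ∑ i ∈ Finset.range (n + 1), homogeneousLength deg d i := by
  have := le_sum_range_of_le_add_sub_two (w := alternateLength deg a)
    (c := fun i => homogeneousLength deg d i) (fun n hn => alternateLength_of_neg hn)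
    (fun n => (h.alternateLength_le_homogeneousLength n).trans_eq (add_comm _ _)) n
  rw [two_mul]
  exact (h.twistedLength_le_alternateLength n).trans
    (add_le_add (this _ (by omega)) (this _ le_rfl))

end TwistedPair

/-! ### Exactness of the twisted Tate complex. -/

section TateResolution

variable {A I : Type*} [CommRing A]

theorem degreeEnd_of_mem (deg : I → ℕ) {p : ℕ} {v : I →₀ A}
    (hv : v ∈ Finsupp.supported A A {t | deg t = p}) : degreeEnd A deg v = (p : A) • v := by
  rw [Finsupp.mem_supported'] at hv
  ext t
  rw [degreeEnd_apply, Finsupp.smul_apply, smul_eq_mul]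
  by_cases ht : deg t = p
  · rw [ht]
  · rw [hv t ht, mul_zero, mul_zero]

/-- Operators defining a twisted differential over the Tate resolution
`Q[x, y]`, `dx = f`, `dy = 2 g x`, of `Q / f`. -/
structure IsTwistedDifferential (deg : I → ℕ) (f g : A) (d a b : Module.End A (I →₀ A)) : Prop where
  d_mem : d ∈ homogeneousEnd A deg 1
  sub_mem : a - d ∈ supportedEnd A (fun s t => deg t + 3 ≤ deg s ∧ Odd (deg t + deg s))
  b_mem : b ∈ supportedEnd A (fun s t => deg t + 2 ≤ deg s ∧ Even (deg t + deg s))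
  mul_self : a * a = -(f • b)
  commutator : a * b - b * a = g • (a * degreeEnd A deg - degreeEnd A deg * a - a)

/-- The differential `(u, v) ↦ (a u + f v, b u - a v + g (n - deg) u)`. -/
noncomputable def tateDiff (deg : I → ℕ) (f g : A) (a b : Module.End A (I →₀ A)) (n : ℤ) :
    Module.End A ((I →₀ A) × (I →₀ A)) :=
  (a ∘ₗ LinearMap.fst A _ _ + f • LinearMap.snd A _ _).prod
    (b ∘ₗ LinearMap.fst A _ _ - a ∘ₗ LinearMap.snd A _ _ +
      g • ((n : A) • LinearMap.fst A _ _ - degreeEnd A deg ∘ₗ LinearMap.fst A _ _))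

variable {deg : I → ℕ} {f g : A} {d a b : Module.End A (I →₀ A)}

theorem tateDiff_apply (n : ℤ) (x : (I →₀ A) × (I →₀ A)) :
    tateDiff deg f g a b n x =
      (a x.1 + f • x.2, b x.1 - a x.2 + g • ((n : A) • x.1 - degreeEnd A deg x.1)) := rfl

/-- The factor n - deg is zero in degree n: terms free of y have zero derivative in y. -/
theorem sub_degreeEnd_mem {n : ℤ} {v : I →₀ A} (hv : v ∈ alternatePart A A deg n) :
    (n : A) • v - degreeEnd A deg v ∈ alternatePart A A deg (n - 2) := by
  rw [alternatePart, Finsupp.mem_supported'] at hv ⊢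
  intro t ht
  rw [Finsupp.sub_apply, degreeEnd_apply, Finsupp.smul_apply, smul_eq_mul]
  by_cases h : (deg t : ℤ) = n
  · rw [← h]; simp
  · rw [hv t fun ⟨h1, h2⟩ => ht ⟨?_, ?_⟩, mul_zero, mul_zero, sub_zero] <;>
      rw [Int.even_iff] at * <;> omega

namespace IsTwistedDifferential

variable (h : IsTwistedDifferential deg f g d a b)
include h

theorem a_mem : a ∈ supportedEnd A (fun s t => deg t + 1 ≤ deg s ∧ Odd (deg t + deg s)) := by
  rw [← sub_add_cancel a d]
  refine Submodule.add_mem _ (supportedEnd_mono (fun s t ht => ⟨by omega, ht.2⟩) h.sub_mem)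
    (supportedEnd_mono (fun s t ht => ⟨by omega, ?_⟩) h.d_mem)
  rw [Nat.odd_iff]
  omega

theorem a_apply_mem {n : ℤ} {v : I →₀ A} (hv : v ∈ alternatePart A A deg n) :
    a v ∈ alternatePart A A deg (n - 1) :=
  supportedEnd_apply_mem h.a_mem (fun s hs t ht => by
    obtain ⟨h1, h2⟩ := hs
    obtain ⟨h3, h4⟩ := ht
    refine ⟨by omega, ?_⟩
    rw [Int.even_iff] at *
    rw [Nat.odd_iff] at h4
    omega) hv

theorem b_apply_mem {n : ℤ} {v : I →₀ A} (hv : v ∈ alternatePart A A deg n) :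
    b v ∈ alternatePart A A deg (n - 2) :=
  supportedEnd_apply_mem h.b_mem (fun s hs t ht => by
    obtain ⟨h1, h2⟩ := hs
    obtain ⟨h3, h4⟩ := ht
    refine ⟨by omega, ?_⟩
    rw [Int.even_iff] at *
    rw [Nat.even_iff] at h4
    omega) hv

theorem tateDiff_mem {n : ℤ} {x : (I →₀ A) × (I →₀ A)}
    (hx : x ∈ (alternatePart A A deg n).prod (alternatePart A A deg (n - 1))) :
    tateDiff deg f g a b n x ∈
      (alternatePart A A deg (n - 1)).prod (alternatePart A A deg (n - 1 - 1)) := by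
  rw [tateDiff_apply]
  have h2 : n - 1 - 1 = n - 2 := by ring
  refine ⟨Submodule.add_mem _ (h.a_apply_mem hx.1) (Submodule.smul_mem _ _ hx.2),
    Submodule.add_mem _ (Submodule.sub_mem _ ?_ (h.a_apply_mem hx.2)) (Submodule.smul_mem _ _ ?_)⟩
  · rw [h2]; exact h.b_apply_mem hx.1
  · rw [h2]; exact sub_degreeEnd_mem hx.1

/-- The first coordinate vanishes by a² = -fb. In the second, passing from n + 1 to n leaves an
extra g a u, which the term -a of the commutator identity absorbs. -/
theorem tateDiff_tateDiff (hfg : f * g = 0) (n : ℤ) (x : (I →₀ A) × (I →₀ A)) :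
    tateDiff deg f g a b n (tateDiff deg f g a b (n + 1) x) = 0 := by
  have haa : ∀ v, a (a v) = -(f • b v) := fun v => LinearMap.congr_fun h.mul_self v
  have hab : ∀ v, a (b v) - b (a v) =
      g • (a (degreeEnd A deg v) - degreeEnd A deg (a v) - a v) :=
    fun v => LinearMap.congr_fun h.commutator v
  have hgf : g * f = 0 := by rw [mul_comm, hfg]
  obtain ⟨u, v⟩ := x
  simp only [tateDiff_apply, map_add, map_sub, map_smul, haa, Int.cast_add, Int.cast_one, add_smul,
    one_smul, smul_add, smul_sub, Prod.mk_eq_zero, smul_smul, hfg, hgf, zero_smul]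
  constructor
  · simp [← mul_assoc, hfg]
  · have e := hab u
    simp only [smul_sub] at e
    have e2 : b (a u) =
        a (b u) - (g • a (degreeEnd A deg u) - g • degreeEnd A deg (a u) - g • a u) := by
      rw [← e]; abel
    rw [e2, show g * ((n : A) * f) = 0 by rw [mul_left_comm, hgf, mul_zero], zero_smul]
    abel

/-- Cycles supported in degrees below `p ≤ n` are boundaries. -/
theorem exists_tateDiff_eq_of_supported (hunit : ∀ n : ℕ, n ≠ 0 → IsUnit (n : A)) (hfg : f * g = 0)
    (hf : ∀ c : A, f * c = 0 → ∃ e, c = g * e) (hg : ∀ c : A, g * c = 0 → ∃ e, c = f * e)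
    (n p : ℕ) (hp : p ≤ n) :
    ∀ x ∈ (alternatePart A A deg n).prod (alternatePart A A deg (n - 1)),
      x.1 ∈ Finsupp.supported A A {t | deg t < p} → x.2 ∈ Finsupp.supported A A {t | deg t < p} →
      tateDiff deg f g a b n x = 0 →
      ∃ y ∈ (alternatePart A A deg (n + 1)).prod (alternatePart A A deg n),
        tateDiff deg f g a b (n + 1) y = x := by
  induction p with
  | zero =>
    rintro ⟨u, v⟩ - hu hv -
    have h0 : {t | deg t < 0} = (∅ : Set I) := by ext; simp
    rw [h0, Finsupp.supported_empty, Submodule.mem_bot] at hu hv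
    exact ⟨0, Submodule.zero_mem _, by simp only at hu hv; rw [map_zero, hu, hv]; rfl⟩
  | succ p ih =>
    rintro ⟨u, v⟩ ⟨huW, hvW⟩ hu hv huv
    simp only at huW hvW hu hv
    have hlow : ∀ w ∈ Finsupp.supported A A {t | deg t < p + 1},
        a w ∈ Finsupp.supported A A {t | deg t < p} ∧
        b w ∈ Finsupp.supported A A {t | deg t < p} := fun w hw =>
      ⟨supportedEnd_apply_mem h.a_mem (fun s hs t ht => by
          simp only [Set.mem_ofPred_eq] at hs ⊢; omega) hw,
        supportedEnd_apply_mem h.b_mem (fun s hs t ht => by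
          simp only [Set.mem_ofPred_eq] at hs ⊢; omega) hw⟩
    rw [tateDiff_apply] at huv
    have e1 : a u + f • v = 0 := congrArg Prod.fst huv
    have e2 : b u - a v + g • (((n : ℤ) : A) • u - degreeEnd A deg u) = 0 := congrArg Prod.snd huv
    -- In the top degree p the operators a and b contribute nothing, so the cycle equations become
    -- those of the Tate complex: f v = 0 and (n - p) g u = 0. Here p < n, so n - p is a unit.
    have hv0 : ∀ t, deg t = p → f * v t = 0 := by
      intro t ht
      have := DFunLike.congr_fun e1 t
      rwa [Finsupp.add_apply, (Finsupp.mem_supported' _ _).1 (hlow u hu).1 t (by simp [ht]),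
        zero_add] at this
    have hu0 : ∀ t, deg t = p → g * u t = 0 := by
      intro t ht
      have := DFunLike.congr_fun e2 t
      rw [Finsupp.add_apply, Finsupp.sub_apply,
        (Finsupp.mem_supported' _ _).1 (hlow u hu).2 t (by simp [ht]),
        (Finsupp.mem_supported' _ _).1 (hlow v hv).1 t (by simp [ht]), sub_zero, zero_add,
        Finsupp.smul_apply, Finsupp.sub_apply, Finsupp.smul_apply, degreeEnd_apply, ht,
        smul_eq_mul, smul_eq_mul, ← sub_mul] at this
      have hc : ((n : ℤ) : A) - p = ((n - p : ℕ) : A) := by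
        rw [Nat.cast_sub (by omega)]; simp
      rw [hc, mul_left_comm] at this
      exact ((hunit (n - p) (by omega)).mul_right_eq_zero).1 this
    obtain ⟨w₁, hw₁, hw₁u⟩ := Finsupp.exists_eq_smul_of_forall (g := f)
      (S := {t | (deg t : ℤ) = p ∧ Even ((n : ℤ) - deg t)}) (v := homogeneousProj A A deg p u)
      (by
        rw [Finsupp.mem_supported']
        intro t ht
        rw [homogeneousProj_apply]
        split_ifs with hd
        · exact (Finsupp.mem_supported' _ _).1 huW t fun h => ht ⟨hd, h.2⟩
        · rfl)
      (fun t => by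
        rw [homogeneousProj_apply]
        split_ifs with hd
        · exact hg _ (hu0 t (by exact_mod_cast hd))
        · exact ⟨0, by simp⟩)
    obtain ⟨w₂, hw₂, hw₂v⟩ := Finsupp.exists_eq_smul_of_forall (g := g)
      (S := {t | (deg t : ℤ) = p ∧ Even ((n : ℤ) - 1 - deg t)}) (v := homogeneousProj A A deg p v)
      (by
        rw [Finsupp.mem_supported']
        intro t ht
        rw [homogeneousProj_apply]
        split_ifs with hd
        · exact (Finsupp.mem_supported' _ _).1 hvW t fun h => ht ⟨hd, h.2⟩
        · rfl)
      (fun t => by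
        rw [homogeneousProj_apply]
        split_ifs with hd
        · exact hf _ (hv0 t (by exact_mod_cast hd))
        · exact ⟨0, by simp⟩)
    -- The differential from total degree n + 1 multiplies g w₂ by n + 1 - p, as w₂ has degree p; w₂
    -- is divided by this beforehand.
    obtain ⟨c, hc⟩ := hunit (n + 1 - p) (by omega)
    have hw₁W : w₁ ∈ alternatePart A A deg n := by
      refine Finsupp.supported_mono (fun t ht => ?_) hw₁
      exact ⟨by have := ht.1; omega, ht.2⟩
    have hw₂W : (↑c⁻¹ : A) • w₂ ∈ alternatePart A A deg (n + 1) := by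
      refine Submodule.smul_mem _ _ (Finsupp.supported_mono (fun t ht => ?_) hw₂)
      exact ⟨by have := ht.1; omega, by have := ht.2; rw [Int.even_iff] at *; omega⟩
    have hw₁p : w₁ ∈ Finsupp.supported A A {t | deg t < p + 1} :=
      Finsupp.supported_mono (fun t ht => by
        have := ht.1; simp only [Set.mem_ofPred_eq]; omega) hw₁
    have hw₂p : (↑c⁻¹ : A) • w₂ ∈ Finsupp.supported A A {t | deg t < p + 1} :=
      Submodule.smul_mem _ _ (Finsupp.supported_mono (fun t ht => by
        have := ht.1; simp only [Set.mem_ofPred_eq]; omega) hw₂)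
    have hy : ((↑c⁻¹ : A) • w₂, w₁) ∈
        (alternatePart A A deg (n + 1)).prod (alternatePart A A deg n) := ⟨hw₂W, hw₁W⟩
    have hdeg : ((n + 1 : ℤ) : A) • w₂ - degreeEnd A deg w₂ = (c : A) • w₂ := by
      rw [degreeEnd_of_mem deg (p := p) (Finsupp.supported_mono (fun t ht => by
        have := ht.1; simp only [Set.mem_ofPred_eq]; omega) hw₂), ← sub_smul, hc,
        Nat.cast_sub (by omega)]
      push_cast
      rfl
    -- This boundary agrees with (u, v) in degree p, so the difference is supported below p and the
    -- induction applies.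
    have hD : tateDiff deg f g a b (n + 1) ((↑c⁻¹ : A) • w₂, w₁) =
        (a ((↑c⁻¹ : A) • w₂) + homogeneousProj A A deg p u,
          b ((↑c⁻¹ : A) • w₂) - a w₁ + homogeneousProj A A deg p v) := by
      rw [tateDiff_apply]
      simp only
      rw [hw₁u, hw₂v, map_smul (degreeEnd A deg), smul_comm _ (↑c⁻¹ : A), ← smul_sub, hdeg,
        smul_smul (↑c⁻¹ : A), Units.inv_mul, one_smul]
    have hproj : ∀ w ∈ Finsupp.supported A A {t | deg t < p + 1},
        w - homogeneousProj A A deg p w ∈ Finsupp.supported A A {t | deg t < p} := by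
      intro w hw
      rw [Finsupp.mem_supported'] at hw ⊢
      intro t ht
      rw [Finsupp.sub_apply, homogeneousProj_apply]
      split_ifs with hd
      · exact sub_self _
      · rw [sub_zero]
        refine hw t fun h => ht ?_
        simp only [Set.mem_ofPred_eq] at h ⊢
        omega
    obtain ⟨z, hz, hzD⟩ := ih (by omega)
      ((u, v) - tateDiff deg f g a b (n + 1) ((↑c⁻¹ : A) • w₂, w₁))
      (Submodule.sub_mem _ ⟨huW, hvW⟩ (by
        have := h.tateDiff_mem (n := n + 1) (x := ((↑c⁻¹ : A) • w₂, w₁)) (by simpa using hy)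
        simpa using this))
      (by
        rw [hD]
        have := Submodule.sub_mem _ (hproj u hu) (hlow _ hw₂p).1
        convert this using 1
        simp only [Prod.fst_sub]
        abel)
      (by
        rw [hD]
        have := Submodule.add_mem _ (Submodule.sub_mem _ (hproj v hv) (hlow _ hw₂p).2)
          (hlow _ hw₁p).1
        convert this using 1
        simp only [Prod.snd_sub]
        abel)
      (by rw [map_sub, h.tateDiff_tateDiff hfg, sub_zero, tateDiff_apply]; exact huv)
    exact ⟨z + ((↑c⁻¹ : A) • w₂, w₁), Submodule.add_mem _ hz hy, by
      rw [map_add, hzD, sub_add_cancel]⟩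

/-- In degree n the factor n - deg is zero, so the Tate complex alone gives no control there; the
last hypothesis supplies it from the resolution modulo f. Subtracting the differential of (w, w')
leaves a cycle supported below degree n. -/
theorem exists_tateDiff_eq (hunit : ∀ n : ℕ, n ≠ 0 → IsUnit (n : A)) (hfg : f * g = 0)
    (hf : ∀ c : A, f * c = 0 → ∃ e, c = g * e) (hg : ∀ c : A, g * c = 0 → ∃ e, c = f * e)
    (n : ℕ) (x : (I →₀ A) × (I →₀ A))
    (hx : x ∈ (alternatePart A A deg n).prod (alternatePart A A deg (n - 1)))
    (hDx : tateDiff deg f g a b n x = 0)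
    (hx1 : ∃ w ∈ homogeneousPart A A deg (n + 1), ∃ w' ∈ homogeneousPart A A deg n,
      homogeneousProj A A deg n x.1 = d w + f • w') :
    ∃ y ∈ (alternatePart A A deg (n + 1)).prod (alternatePart A A deg n),
        tateDiff deg f g a b (n + 1) y = x := by
  obtain ⟨w, hw, w', hw', e⟩ := hx1
  obtain ⟨u, v⟩ := x
  obtain ⟨hu, hv⟩ := hx
  simp only at hu hv e
  have hy : (w, w') ∈ (alternatePart A A deg (n + 1)).prod (alternatePart A A deg n) :=
    ⟨homogeneousPart_le_alternatePart _ hw, homogeneousPart_le_alternatePart _ hw'⟩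
  have hdeg : ((n + 1 : ℤ) : A) • w - degreeEnd A deg w = 0 := by
    rw [degreeEnd_of_mem deg (p := n + 1) (Finsupp.supported_mono (fun t ht => by
        simp only [Set.mem_ofPred_eq] at ht ⊢; omega) hw)]
    push_cast
    exact sub_self _
  have hD : tateDiff deg f g a b (n + 1) (w, w') = (a w + f • w', b w - a w') := by
    rw [tateDiff_apply]
    simp only
    rw [hdeg, smul_zero, add_zero]
  have hwlt : ∀ z ∈ alternatePart A A deg ((n : ℤ) - 1),
      z ∈ Finsupp.supported A A {t | deg t < n} :=
    fun z hz => Finsupp.supported_mono (fun t ht => by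
      have := ht.1; simp only [Set.mem_ofPred_eq]; omega) hz
  have hwlt' : ∀ z ∈ alternatePart A A deg ((n : ℤ) - 2),
      z ∈ Finsupp.supported A A {t | deg t < n} :=
    fun z hz => Finsupp.supported_mono (fun t ht => by
      have := ht.1; simp only [Set.mem_ofPred_eq]; omega) hz
  obtain ⟨z, hz, hzD⟩ := h.exists_tateDiff_eq_of_supported hunit hfg hf hg n n le_rfl
      ((u, v) - tateDiff deg f g a b (n + 1) (w, w'))
      (Submodule.sub_mem _ ⟨hu, hv⟩ (by
        have := h.tateDiff_mem (n := n + 1) (x := (w, w')) (by simpa using hy)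
        simpa using this))
      (by
        rw [hD]
        have h1 : (a - d) w ∈ Finsupp.supported A A {t | deg t < n} :=
          supportedEnd_apply_mem h.sub_mem (fun s hs t ht => by
            simp only [Set.mem_ofPred_eq] at hs ⊢; omega) hw
        have := Submodule.sub_mem _ (hwlt' _ (sub_homogeneousProj_mem hu)) h1
        convert this using 1
        rw [e]
        simp only [Prod.fst_sub, LinearMap.sub_apply]
        abel)
      (by
        rw [hD]
        exact Submodule.sub_mem _ (hwlt _ hv) (Submodule.sub_mem _
          (hwlt _ (mem_alternatePart_of_eq (h.b_apply_mem hy.1) (by ring)))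
          (hwlt _ (h.a_apply_mem hy.2))))
      (by rw [map_sub, h.tateDiff_tateDiff hfg, sub_zero, hDx])
  exact ⟨z + (w, w'), Submodule.add_mem _ hz hy, by rw [map_add, hzD, sub_add_cancel]⟩

end IsTwistedDifferential

end TateResolution

/-! ### Base change of graded pieces. -/

section SupportedTensor

variable {A I : Type*} [CommRing A] (N : Type*) [AddCommGroup N] [Module A N]

/-- The tensor product of a free module on a subset of a basis with `N`. -/
noncomputable def supportedTensorEquiv (S : Set I) :
    (Finsupp.supported A A S) ⊗[A] N ≃ₗ[A] Finsupp.supported N A S :=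
  (Finsupp.supportedEquivFinsupp S).rTensor N ≪≫ₗ freeTensorEquiv A S N ≪≫ₗ
    (Finsupp.supportedEquivFinsupp S).symm

variable {N}

theorem coe_supportedTensorEquiv_tmul (S : Set I) (v : Finsupp.supported A A S) (x : N) :
    (supportedTensorEquiv N S (v ⊗ₜ x) : I →₀ N) = freeTensorEquiv A I N ((v : I →₀ A) ⊗ₜ x) := by
  ext t
  rw [freeTensorEquiv_tmul_apply]
  by_cases ht : t ∈ S
  · have h : Finsupp.supportedEquivFinsupp S (supportedTensorEquiv N S (v ⊗ₜ x)) =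
        freeTensorEquiv A S N (Finsupp.supportedEquivFinsupp S v ⊗ₜ x) := by
      simp [supportedTensorEquiv]
    have := DFunLike.congr_fun h ⟨t, ht⟩
    rwa [freeTensorEquiv_tmul_apply] at this
  · rw [(Finsupp.mem_supported' _ _).1 (supportedTensorEquiv N S (v ⊗ₜ x)).2 t ht,
      (Finsupp.mem_supported' _ _).1 v.2 t ht, zero_smul]

variable (N) in
/-- The tensor product of a homogeneous part of a free module with `N`. -/
noncomputable def homogeneousTensorEquiv (deg : I → ℕ) (n : ℤ) :
    homogeneousPart A A deg n ⊗[A] N ≃ₗ[A] homogeneousPart A N deg n :=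
  supportedTensorEquiv N _

theorem coe_homogeneousTensorEquiv_tmul (deg : I → ℕ) (n : ℤ) (v : homogeneousPart A A deg n)
    (x : N) : (homogeneousTensorEquiv N deg n (v ⊗ₜ x) : I →₀ N) =
      freeTensorEquiv A I N ((v : I →₀ A) ⊗ₜ x) :=
  coe_supportedTensorEquiv_tmul _ v x

variable (N) in
/-- The tensor product of a pair of alternate parts of a free module with `N`. -/
noncomputable def pairTensorEquiv (deg : I → ℕ) (m n : ℤ) :
    (alternatePart A A deg m × alternatePart A A deg n) ⊗[A] N ≃ₗ[A]
      alternatePart A N deg m × alternatePart A N deg n :=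
  TensorProduct.prodLeft A A _ _ _ ≪≫ₗ
    LinearEquiv.prodCongr (supportedTensorEquiv N _ :
      alternatePart A A deg m ⊗[A] N ≃ₗ[A] alternatePart A N deg m) (supportedTensorEquiv N _)

theorem coe_pairTensorEquiv_tmul (deg : I → ℕ) (m n : ℤ)
    (v : alternatePart A A deg m × alternatePart A A deg n) (x : N) :
    (alternatePart A N deg m).subtype.prodMap (alternatePart A N deg n).subtype
      (pairTensorEquiv N deg m n (v ⊗ₜ x)) =
    (freeTensorEquiv A I N ((v.1 : I →₀ A) ⊗ₜ x), freeTensorEquiv A I N ((v.2 : I →₀ A) ⊗ₜ x)) :=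
  Prod.ext (coe_supportedTensorEquiv_tmul _ v.1 x) (coe_supportedTensorEquiv_tmul _ v.2 x)

theorem coeffEnd_freeTensorEquiv_tmul (h : Module.End A (I →₀ A)) (v : I →₀ A) (x : N) :
    coeffEnd N h (freeTensorEquiv A I N (v ⊗ₜ x)) = freeTensorEquiv A I N (h v ⊗ₜ x) := by
  rw [coeffEnd_freeTensorEquiv, LinearMap.rTensor_tmul]

end SupportedTensor

/-! ### Restriction of endomorphisms of pairs. -/

section PairRestrict

variable {A V : Type*} [CommRing A] [AddCommGroup V] [Module A V]

/-- The restriction of an endomorphism of `V × V` to products of submodules. -/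
def pairRestrict (T : Module.End A (V × V)) {p q p' q' : Submodule A V}
    (hT : ∀ x ∈ p.prod q, T x ∈ p'.prod q') : (p × q) →ₗ[A] (p' × q') :=
  ((LinearMap.fst A V V ∘ₗ T ∘ₗ p.subtype.prodMap q.subtype).codRestrict p'
    fun x => (hT (x.1, x.2) ⟨x.1.2, x.2.2⟩).1).prod
  ((LinearMap.snd A V V ∘ₗ T ∘ₗ p.subtype.prodMap q.subtype).codRestrict q'
    fun x => (hT (x.1, x.2) ⟨x.1.2, x.2.2⟩).2)

theorem prodMap_pairRestrict (T : Module.End A (V × V)) {p q p' q' : Submodule A V}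
    (hT : ∀ x ∈ p.prod q, T x ∈ p'.prod q') (x : p × q) :
    p'.subtype.prodMap q'.subtype (pairRestrict T hT x) = T (p.subtype.prodMap q.subtype x) := rfl

theorem prodMap_subtype_injective (p q : Submodule A V) :
    Function.Injective (p.subtype.prodMap q.subtype) :=
  Prod.map_injective.2 ⟨p.injective_subtype, q.injective_subtype⟩

end PairRestrict

/-! ### Both Tor lengths as homology lengths of graded vectors. -/

section TorLength

variable {A : Type u} {I : Type} [CommRing A] {M N : Type u} [AddCommGroup M] [Module A M]
  [AddCommGroup N] [Module A N] {deg : I → ℕ}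

instance (S : Set I) : Module.Projective A (Finsupp.supported A A S) :=
  Module.Projective.of_equiv (Finsupp.supportedEquivFinsupp (M := A) (R := A) S).symm

instance (n : ℤ) : Module.Projective A (homogeneousPart A A deg n) :=
  inferInstanceAs (Module.Projective A (Finsupp.supported A A _))

instance (n : ℤ) : Module.Projective A (alternatePart A A deg n) :=
  inferInstanceAs (Module.Projective A (Finsupp.supported A A _))

theorem mem_homogeneousPart_of_eq {A I N : Type*} [CommRing A] [AddCommGroup N] [Module A N]
    {deg : I → ℕ} {m n : ℤ} {v : I →₀ N} (hv : v ∈ homogeneousPart A N deg m)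
    (h : m = n) : v ∈ homogeneousPart A N deg n := h ▸ hv

theorem coeffEnd_homogeneous_mem {d : Module.End A (I →₀ A)} (hd : d ∈ homogeneousEnd A deg 1)
    (n : ℤ) (v : I →₀ N) (hv : v ∈ homogeneousPart A N deg n) :
    coeffEnd N d v ∈ homogeneousPart A N deg (n - 1) :=
  coeffEnd_apply_mem hd (fun s hs t ht => by simp only [Set.mem_ofPred_eq] at hs ⊢; omega) hv

/-- The length of `Tor` computed by a graded free resolution. -/
theorem torLength_eq_homogeneousLength (d : Module.End A (I →₀ A))
    (hd : d ∈ homogeneousEnd A deg 1) (hdd : d * d = 0) (ε : (I →₀ A) →ₗ[A] M)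
    (hεd : ∀ v ∈ homogeneousPart A A deg 1, ε (d v) = 0)
    (hε : ∀ m, ∃ v ∈ homogeneousPart A A deg 0, ε v = m)
    (hex : ∀ n : ℕ, ∀ v ∈ homogeneousPart A A deg (n + 1), d v = 0 →
      ∃ w ∈ homogeneousPart A A deg (n + 2), d w = v)
    (hexε : ∀ v ∈ homogeneousPart A A deg 0, ε v = 0 → ∃ w ∈ homogeneousPart A A deg 1, d w = v)
    (n : ℕ) :
    torLength A M N n = homogeneousLength deg (coeffEnd N d) n := by
  have hd1 : ∀ n : ℕ, ∀ v ∈ homogeneousPart A A deg (n + 1 : ℕ), d v ∈ homogeneousPart A A deg n :=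
    fun n v hv => supportedEnd_apply_mem hd (fun s hs t ht => by
      simp only [Set.mem_ofPred_eq] at hs ⊢; omega) hv
  have hd2 : ∀ n : ℕ, ∀ v ∈ homogeneousPart A N deg (n + 1 : ℕ),
      coeffEnd N d v ∈ homogeneousPart A N deg n :=
    fun n v hv => coeffEnd_apply_mem hd (fun s hs t ht => by
      simp only [Set.mem_ofPred_eq] at hs ⊢; omega) hv
  rw [torLength_eq_relLength (fun n : ℕ => homogeneousPart A A deg n)
    (fun n => d.restrict (hd1 n)) (ε ∘ₗ (homogeneousPart A A deg (0 : ℕ)).subtype) ?_ ?_ ?_ ?_ ?_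
    (C' := fun n : ℕ => homogeneousPart A N deg n) (fun n => (coeffEnd N d).restrict (hd2 n))
    (fun n => homogeneousTensorEquiv N deg n) ?_ n]
  · rw [homogeneousLength, ← relLength_map _ (homogeneousPart A N deg n).injective_subtype]
    congr 1
    · cases n with
      | zero =>
        have : homogeneousPart A N deg (0 : ℕ) ≤ LinearMap.ker (coeffEnd N d) := by
          intro v hv
          have := coeffEnd_homogeneous_mem hd _ v hv
          have := homogeneousPart_le_alternatePart _ this
          rwa [alternatePart_of_neg (by simp), Submodule.mem_bot] at this
        rw [inf_of_le_left this]
        simp [seqCycles]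
      | succ n =>
        ext v
        simp only [seqCycles, Submodule.mem_map, Submodule.mem_inf, LinearMap.mem_ker]
        constructor
        · rintro ⟨w, hw, rfl⟩
          exact ⟨w.2, congrArg Subtype.val hw⟩
        · rintro ⟨hv, hdv⟩
          exact ⟨⟨v, hv⟩, Subtype.ext hdv, rfl⟩
    · ext v
      simp only [Submodule.mem_map, LinearMap.mem_range]
      constructor
      · rintro ⟨_, ⟨w, rfl⟩, rfl⟩
        exact ⟨w, mem_homogeneousPart_of_eq w.2 (by push_cast; rfl), rfl⟩
      · rintro ⟨w, hw, rfl⟩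
        exact ⟨_, ⟨⟨w, mem_homogeneousPart_of_eq hw (by push_cast; rfl)⟩, rfl⟩, rfl⟩
  · intro n x
    exact Subtype.ext (LinearMap.congr_fun hdd x)
  · intro x
    exact hεd x (mem_homogeneousPart_of_eq x.2 (by simp))
  · intro n x hx
    obtain ⟨w, hw, hwx⟩ := hex n x (mem_homogeneousPart_of_eq x.2 (by push_cast; rfl))
      (congrArg Subtype.val hx)
    exact ⟨⟨w, mem_homogeneousPart_of_eq hw (by push_cast; ring)⟩, Subtype.ext hwx⟩
  · intro x hx
    obtain ⟨w, hw, hwx⟩ := hexε x (mem_homogeneousPart_of_eq x.2 (by simp)) hx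
    exact ⟨⟨w, mem_homogeneousPart_of_eq hw (by simp)⟩, Subtype.ext hwx⟩
  · intro m
    obtain ⟨v, hv, hvm⟩ := hε m
    exact ⟨⟨v, mem_homogeneousPart_of_eq hv (by simp)⟩, hvm⟩
  · intro n x y
    refine Subtype.ext ?_
    rw [LinearMap.coe_restrict_apply, coe_homogeneousTensorEquiv_tmul,
      coe_homogeneousTensorEquiv_tmul, coeffEnd_freeTensorEquiv_tmul]
    rfl

theorem alternatePart_le_homogeneousPart {N : Type*} [AddCommGroup N] [Module A N] {n : ℤ}
    (hn : n < 2) : alternatePart A N deg n ≤ homogeneousPart A N deg n :=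
  Finsupp.supported_mono fun t ⟨h1, h2⟩ => by
    rw [Int.even_iff] at h2
    simp only [Set.mem_ofPred_eq]
    omega

namespace IsTwistedDifferential

variable {f g : A} {d a b : Module.End A (I →₀ A)} (h : IsTwistedDifferential deg f g d a b)
include h

theorem homogeneousProj_a {n : ℤ} {v : I →₀ A} (hv : v ∈ alternatePart A A deg (n + 1)) :
    homogeneousProj A A deg n (a v) = d (homogeneousProj A A deg (n + 1) v) := by
  refine homogeneousProj_eq_of_sub_mem (fun n v hv => ?_) (fun n v hv => ?_)
    (fun n v hv => h.a_apply_mem hv) hv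
  · exact supportedEnd_apply_mem h.d_mem (fun s hs t ht => by
      simp only [Set.mem_ofPred_eq] at hs ⊢; omega) hv
  · refine supportedEnd_apply_mem h.sub_mem (fun s hs t ht => ?_) hv
    obtain ⟨h1, h2⟩ := hs
    obtain ⟨h3, h4⟩ := ht
    refine ⟨by omega, ?_⟩
    rw [Int.even_iff] at *
    rw [Nat.odd_iff] at h4
    omega

/-- The obstructions to a² = 0 and to ab = ba are multiples of f and of g, both of which vanish on
N. -/
theorem isTwistedPair (hfN : ∀ x : N, f • x = 0) (hgN : ∀ x : N, g • x = 0) :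
    IsTwistedPair deg (coeffEnd N d) (coeffEnd N a) (coeffEnd N b) where
  d_mem n v hv := coeffEnd_homogeneous_mem h.d_mem n v hv
  sub_mem n v hv := by
    rw [← LinearMap.sub_apply, ← map_sub]
    refine coeffEnd_apply_mem h.sub_mem (fun s hs t ht => ?_) hv
    obtain ⟨h1, h2⟩ := hs
    obtain ⟨h3, h4⟩ := ht
    refine ⟨by omega, ?_⟩
    rw [Int.even_iff] at *
    rw [Nat.odd_iff] at h4
    omega
  a_mem n v hv := by
    refine coeffEnd_apply_mem h.a_mem (fun s hs t ht => ?_) hv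
    obtain ⟨h1, h2⟩ := hs
    obtain ⟨h3, h4⟩ := ht
    refine ⟨by omega, ?_⟩
    rw [Int.even_iff] at *
    rw [Nat.odd_iff] at h4
    omega
  b_mem n v hv := by
    refine coeffEnd_apply_mem h.b_mem (fun s hs t ht => ?_) hv
    obtain ⟨h1, h2⟩ := hs
    obtain ⟨h3, h4⟩ := ht
    refine ⟨by omega, ?_⟩
    rw [Int.even_iff] at *
    rw [Nat.even_iff] at h4
    omega
  a_a v := by
    have hf : ∀ w : I →₀ N, f • w = 0 := fun w => by ext t; exact hfN _
    have h0 : a * a + f • b = 0 := by rw [h.mul_self]; exact neg_add_cancel (f • b)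
    have h1 := LinearMap.congr_fun (congrArg (coeffEnd N) h0) v
    rwa [map_add, map_mul, map_smul, map_zero, LinearMap.add_apply, LinearMap.smul_apply, hf,
      add_zero] at h1
  a_b v := by
    have hg : ∀ w : I →₀ N, g • w = 0 := fun w => by ext t; exact hgN _
    rw [← sub_eq_zero, ← Module.End.mul_apply, ← Module.End.mul_apply, ← LinearMap.sub_apply,
      ← map_mul, ← map_mul, ← map_sub, h.commutator, map_smul, LinearMap.smul_apply, hg]

end IsTwistedDifferential

theorem IsTwistedPair.twistedDiff_mem {d a b : Module.End A (I →₀ N)}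
    (h : IsTwistedPair deg d a b) {n : ℤ} {x : (I →₀ N) × (I →₀ N)}
    (hx : x ∈ (alternatePart A N deg n).prod (alternatePart A N deg (n - 1))) :
    twistedDiff a b x ∈ (alternatePart A N deg (n - 1)).prod (alternatePart A N deg (n - 1 - 1)) :=
  ⟨h.a_mem _ _ hx.1, Submodule.sub_mem _
    (mem_alternatePart_of_eq (h.b_mem _ _ hx.1) (by ring)) (h.a_mem _ _ hx.2)⟩

/-- The length of `Tor` computed by the twisted Tate resolution, for a module killed by `f`
and `g`. -/
theorem torLength_eq_twistedLength {f g : A} {d a b : Module.End A (I →₀ A)}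
    (h : IsTwistedDifferential deg f g d a b)
    (hunit : ∀ n : ℕ, n ≠ 0 → IsUnit (n : A)) (hfg : f * g = 0)
    (hf : ∀ c : A, f * c = 0 → ∃ e, c = g * e) (hg : ∀ c : A, g * c = 0 → ∃ e, c = f * e)
    (hfN : ∀ x : N, f • x = 0) (hgN : ∀ x : N, g • x = 0)
    (ε : (I →₀ A) →ₗ[A] M) (hεf : ∀ v, ε (f • v) = 0)
    (hεd : ∀ v ∈ homogeneousPart A A deg 1, ε (d v) = 0)
    (hε : ∀ m, ∃ v ∈ homogeneousPart A A deg 0, ε v = m)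
    (hex : ∀ n : ℕ, ∀ v ∈ homogeneousPart A A deg (n + 1), (∃ w, d v = f • w) →
      ∃ w ∈ homogeneousPart A A deg (n + 2), ∃ w' ∈ homogeneousPart A A deg (n + 1),
        v = d w + f • w')
    (hexε : ∀ v ∈ homogeneousPart A A deg 0, ε v = 0 →
      ∃ w ∈ homogeneousPart A A deg 1, ∃ w' ∈ homogeneousPart A A deg 0, v = d w + f • w')
    (n : ℕ) :
    torLength A M N n = twistedLength deg (coeffEnd N a) (coeffEnd N b) n := by
  have hP := h.isTwistedPair hfN hgN
  have hcast : ∀ n : ℕ, ((n + 1 : ℕ) : ℤ) = n + 1 := fun n => by push_cast; rfl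
  have hT : ∀ n : ℕ, ∀ x ∈ (alternatePart A A deg (n + 1 : ℕ)).prod
      (alternatePart A A deg ((n + 1 : ℕ) - 1)), tateDiff deg f g a b (n + 1) x ∈
      (alternatePart A A deg n).prod (alternatePart A A deg (n - 1)) := by
    intro n x hx
    rw [hcast] at hx
    simpa using h.tateDiff_mem hx
  have hT' : ∀ n : ℕ, ∀ x ∈ (alternatePart A N deg (n + 1 : ℕ)).prod
      (alternatePart A N deg ((n + 1 : ℕ) - 1)), twistedDiff (coeffEnd N a) (coeffEnd N b) x ∈
      (alternatePart A N deg n).prod (alternatePart A N deg (n - 1)) := by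
    intro n x hx
    rw [hcast] at hx
    simpa using hP.twistedDiff_mem hx
  rw [torLength_eq_relLength
    (fun n : ℕ => alternatePart A A deg n × alternatePart A A deg (n - 1))
    (fun n => pairRestrict (tateDiff deg f g a b (n + 1)) (hT n))
    (ε ∘ₗ (alternatePart A A deg (0 : ℕ)).subtype ∘ₗ LinearMap.fst A _ _) ?_ ?_ ?_ ?_ ?_
    (C' := fun n : ℕ => alternatePart A N deg n × alternatePart A N deg (n - 1))
    (fun n => pairRestrict (twistedDiff (coeffEnd N a) (coeffEnd N b)) (hT' n))
    (fun n => pairTensorEquiv N deg n (n - 1)) ?_ n]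
  · rw [twistedLength, ← relLength_map _ (prodMap_subtype_injective _ _)]
    congr 1
    · cases n with
      | zero =>
        have : (alternatePart A N deg (0 : ℕ)).prod (alternatePart A N deg ((0 : ℕ) - 1)) ≤
            LinearMap.ker (twistedDiff (coeffEnd N a) (coeffEnd N b)) := by
          intro v hv
          have := hP.twistedDiff_mem hv
          exact Prod.ext (eq_zero_of_mem_alternatePart (by simp) this.1)
            (eq_zero_of_mem_alternatePart (by simp) this.2)
        rw [inf_of_le_left this]
        ext x
        constructor
        · rintro ⟨y, -, rfl⟩
          exact ⟨y.1.2, y.2.2⟩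
        · rintro ⟨h1, h2⟩
          exact ⟨(⟨x.1, h1⟩, ⟨x.2, h2⟩), trivial, rfl⟩
      | succ n =>
        ext x
        simp only [seqCycles, Submodule.mem_map, Submodule.mem_inf, LinearMap.mem_ker]
        constructor
        · rintro ⟨y, hy, rfl⟩
          refine ⟨⟨y.1.2, y.2.2⟩, ?_⟩
          rw [← prodMap_pairRestrict _ (hT' n), hy, map_zero]
        · rintro ⟨⟨h1, h2⟩, hDx⟩
          refine ⟨(⟨x.1, h1⟩, ⟨x.2, h2⟩), prodMap_subtype_injective _ _ ?_, rfl⟩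
          rw [prodMap_pairRestrict, map_zero]
          exact hDx
    · ext x
      constructor
      · rintro ⟨_, ⟨y, rfl⟩, rfl⟩
        refine ⟨(y.1, y.2), ⟨mem_alternatePart_of_eq y.1.2 (hcast n),
          mem_alternatePart_of_eq y.2.2 (by simp)⟩, ?_⟩
        rw [prodMap_pairRestrict]
        rfl
      · rintro ⟨y, hy, rfl⟩
        exact ⟨_, ⟨(⟨y.1, mem_alternatePart_of_eq hy.1 (hcast n).symm⟩,
          ⟨y.2, mem_alternatePart_of_eq hy.2 (by simp)⟩), rfl⟩, rfl⟩
  · intro n x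
    refine prodMap_subtype_injective _ _ ?_
    rw [prodMap_pairRestrict, prodMap_pairRestrict, map_zero, hcast]
    exact h.tateDiff_tateDiff hfg _ _
  · intro x
    have hx : (x.1 : I →₀ A) ∈ alternatePart A A deg 1 := mem_alternatePart_of_eq x.1.2 (by simp)
    -- Since a - d lowers degrees by at least 3, a and d agree in degree at most 1.
    have h0 : (a - d) (x.1 : I →₀ A) = 0 := by
      have := supportedEnd_apply_mem h.sub_mem (S := {t | (deg t : ℤ) ≤ 1 ∧ Even (1 - (deg t : ℤ))})
        (T := ∅) (fun s hs t ht => by have := hs.1; omega) hx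
      rwa [Finsupp.supported_empty, Submodule.mem_bot] at this
    rw [LinearMap.sub_apply, sub_eq_zero] at h0
    change ε (a x.1 + f • (x.2 : I →₀ A)) = 0
    rw [map_add, hεf, add_zero, h0]
    exact hεd _ (alternatePart_le_homogeneousPart (by norm_num) hx)
  · intro n x hx
    have hx' : tateDiff deg f g a b (n + 1) (x.1, x.2) = 0 := by
      have := prodMap_pairRestrict _ (hT n) x
      rw [hx, map_zero] at this
      exact this.symm
    have h1 : a x.1 + f • (x.2 : I →₀ A) = 0 := congrArg Prod.fst hx'
    have hx1 : (x.1 : I →₀ A) ∈ alternatePart A A deg (n + 1) :=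
      mem_alternatePart_of_eq x.1.2 (hcast n)
    -- The degree n component of a u + f v = 0 shows that the leading component of u is a d-cycle
    -- modulo f.
    obtain ⟨w, hw, w', hw', e⟩ := hex n _ (homogeneousProj_mem (n + 1) (x.1 : I →₀ A))
      ⟨-homogeneousProj A A deg n (x.2 : I →₀ A), by
        rw [← h.homogeneousProj_a hx1, smul_neg, ← map_smul, ← map_neg,
          eq_neg_of_add_eq_zero_left h1]⟩
    obtain ⟨y, hy, hyx⟩ := h.exists_tateDiff_eq hunit hfg hf hg (n + 1) (x.1, x.2)
      ⟨x.1.2, x.2.2⟩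
      ((congrArg (fun k : ℤ => tateDiff deg f g a b k (x.1, x.2)) (hcast n)).trans hx')
      ⟨w, mem_homogeneousPart_of_eq hw (by push_cast; ring), w',
        mem_homogeneousPart_of_eq hw' (by push_cast; ring),
        (congrArg (fun k : ℤ => homogeneousProj A A deg k (x.1 : I →₀ A)) (hcast n)).trans e⟩
    refine ⟨(⟨y.1, mem_alternatePart_of_eq hy.1 (by push_cast; ring)⟩,
      ⟨y.2, mem_alternatePart_of_eq hy.2 (by push_cast; ring)⟩), prodMap_subtype_injective _ _ ?_⟩
    rw [prodMap_pairRestrict]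
    exact hyx
  · intro x hx
    have hx1 : (x.1 : I →₀ A) ∈ homogeneousPart A A deg 0 :=
      alternatePart_le_homogeneousPart (by norm_num) (mem_alternatePart_of_eq x.1.2 (by simp))
    obtain ⟨w, hw, w', hw', e⟩ := hexε x.1 hx1 hx
    obtain ⟨y, hy, hyx⟩ := h.exists_tateDiff_eq hunit hfg hf hg 0 (x.1, x.2)
      ⟨x.1.2, x.2.2⟩ (by
        have := h.tateDiff_mem (n := (0 : ℕ)) (x := (x.1, x.2)) ⟨x.1.2, x.2.2⟩
        exact Prod.ext (eq_zero_of_mem_alternatePart (by simp) this.1)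
          (eq_zero_of_mem_alternatePart (by simp) this.2))
      ⟨w, mem_homogeneousPart_of_eq hw (by simp), w',
        mem_homogeneousPart_of_eq hw' (by simp), by
          rw [← e]; exact homogeneousProj_of_mem (mem_homogeneousPart_of_eq hx1 (by simp))⟩
    refine ⟨(⟨y.1, mem_alternatePart_of_eq hy.1 (by simp)⟩,
      ⟨y.2, mem_alternatePart_of_eq hy.2 (by simp)⟩), prodMap_subtype_injective _ _ ?_⟩
    rw [prodMap_pairRestrict]
    exact hyx
  · intro m
    obtain ⟨v, hv, hvm⟩ := hε m
    exact ⟨(⟨v, mem_alternatePart_of_eq (homogeneousPart_le_alternatePart _ hv) (by simp)⟩, 0), hvm⟩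
  · rintro n ⟨u, v⟩ y
    -- Removes the terms of `tateDiff` with factor f or g, which leaves `twistedDiff`.
    have hE : ∀ (c : A) (w : I →₀ A), c • y = 0 → freeTensorEquiv A I N ((c • w) ⊗ₜ y) = 0 :=
      fun c w hc => by rw [TensorProduct.smul_tmul, hc, TensorProduct.tmul_zero, map_zero]
    refine prodMap_subtype_injective _ _ ?_
    rw [prodMap_pairRestrict, coe_pairTensorEquiv_tmul, coe_pairTensorEquiv_tmul]
    refine Prod.ext ?_ ?_
    · change coeffEnd N a (freeTensorEquiv A I N ((u : I →₀ A) ⊗ₜ y)) =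
        freeTensorEquiv A I N ((a u + f • (v : I →₀ A)) ⊗ₜ y)
      rw [coeffEnd_freeTensorEquiv_tmul, TensorProduct.add_tmul, map_add, hE _ _ (hfN y), add_zero]
    · change coeffEnd N b (freeTensorEquiv A I N ((u : I →₀ A) ⊗ₜ y)) -
          coeffEnd N a (freeTensorEquiv A I N ((v : I →₀ A) ⊗ₜ y)) =
        freeTensorEquiv A I N ((b u - a v + g • _) ⊗ₜ y)
      rw [coeffEnd_freeTensorEquiv_tmul, coeffEnd_freeTensorEquiv_tmul, TensorProduct.add_tmul,
        map_add, hE _ _ (hgN y), add_zero, TensorProduct.sub_tmul, map_sub]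

end TorLength

/-! ### Graded free resolutions over a Noetherian ring. -/

section GradedResolution

variable {B M : Type*} [CommRing B] [IsNoetherianRing B] [AddCommGroup M] [Module B M]

theorem exists_linearMap_range_eq {m : ℕ} (K : Submodule B (Fin m →₀ B)) :
    ∃ (m' : ℕ) (φ : (Fin m' →₀ B) →ₗ[B] (Fin m →₀ B)), LinearMap.range φ = K := by
  obtain ⟨m', ψ, hψ⟩ := Module.Finite.exists_fin' B K
  refine ⟨m', K.subtype ∘ₗ ψ ∘ₗ (Finsupp.linearEquivFunOnFinite B B (Fin m')).toLinearMap, ?_⟩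
  rw [LinearMap.range_comp, LinearMap.range_eq_top.2, Submodule.map_top, Submodule.range_subtype]
  exact hψ.comp (LinearEquiv.surjective _)

theorem exists_finite_free_resolution [Module.Finite B M] :
    ∃ (r : ℕ → ℕ) (φ : ∀ k, (Fin (r (k + 1)) →₀ B) →ₗ[B] (Fin (r k) →₀ B))
      (ε : (Fin (r 0) →₀ B) →ₗ[B] M), Function.Surjective ε ∧
      LinearMap.range (φ 0) = LinearMap.ker ε ∧
      ∀ k, LinearMap.range (φ (k + 1)) = LinearMap.ker (φ k) := by
  obtain ⟨m₀, ε₀, hε₀⟩ := Module.Finite.exists_fin' B M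
  choose! r' φ hφ using fun X : Σ m : ℕ, Submodule B (Fin m →₀ B) => exists_linearMap_range_eq X.2
  let ε : (Fin m₀ →₀ B) →ₗ[B] M := ε₀ ∘ₗ (Finsupp.linearEquivFunOnFinite B B (Fin m₀)).toLinearMap
  -- The state of the recursion is a finite free module with the syzygy submodule to be covered
  -- next.
  let S : ℕ → Σ m : ℕ, Submodule B (Fin m →₀ B) := fun n =>
    Nat.rec ⟨m₀, LinearMap.ker ε⟩ (fun _ X => ⟨r' X, LinearMap.ker (φ X)⟩) n
  exact ⟨fun k => (S k).1, fun k => φ (S k), ε, hε₀.comp (LinearEquiv.surjective _), hφ (S 0),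
    fun k => hφ (S (k + 1))⟩

/-- A module with a resolution by finite free modules has a graded free resolution with finitely
many basis elements in each degree. -/
theorem exists_graded_resolution [Module.Finite B M] :
    ∃ (I : Type) (deg : I → ℕ) (d : Module.End B (I →₀ B)) (ε : (I →₀ B) →ₗ[B] M),
      (∀ n, Finite {t // deg t = n}) ∧ d ∈ homogeneousEnd B deg 1 ∧ d * d = 0 ∧
      (∀ v ∈ homogeneousPart B B deg 1, ε (d v) = 0) ∧
      (∀ m, ∃ v ∈ homogeneousPart B B deg 0, ε v = m) ∧
      (∀ n : ℕ, ∀ v ∈ homogeneousPart B B deg (n + 1), d v = 0 →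
        ∃ w ∈ homogeneousPart B B deg (n + 2), d w = v) ∧
      (∀ v ∈ homogeneousPart B B deg 0, ε v = 0 → ∃ w ∈ homogeneousPart B B deg 1, d w = v) := by
  obtain ⟨r, φ, ε₀, hε₀, h0, h1⟩ := exists_finite_free_resolution (B := B) (M := M)
  let I := Σ k : ℕ, Fin (r k)
  let s (k : ℕ) (j : Fin (r k)) : I := ⟨k, j⟩
  have hs : ∀ k, Function.Injective (s k) := fun k => sigma_mk_injective (β := fun k => Fin (r k))
  let i (k : ℕ) : (Fin (r k) →₀ B) →ₗ[B] (I →₀ B) := Finsupp.lmapDomain B B (s k)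
  have hi : ∀ k, Function.Injective (i k) := fun k =>
    Finsupp.mapDomain_injective (hs k)
  have mem_i : ∀ (k : ℕ) w, i k w ∈ homogeneousPart B B (Sigma.fst : I → ℕ) k := by
    intro k w
    refine (Finsupp.mem_supported' _ _).2 fun t ht => ?_
    refine Finsupp.mapDomain_of_notMem_range _ _ ?_
    rintro ⟨j, rfl⟩
    exact ht rfl
  have ex_i : ∀ (k : ℕ) (n : ℤ), n = k → ∀ v ∈ homogeneousPart B B (Sigma.fst : I → ℕ) n,
      ∃ w, i k w = v := by
    rintro k _ rfl v hv
    refine ⟨v.comapDomain (s k) (hs k).injOn,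
      Finsupp.mapDomain_comapDomain _ (hs k) _ fun t ht => ?_⟩
    have : (t.1 : ℤ) = k := hv ht
    obtain ⟨l, j⟩ := t
    obtain rfl : l = k := by exact_mod_cast this
    exact ⟨j, rfl⟩
  let D : I → (I →₀ B) := fun t => match t with
    | ⟨0, _⟩ => 0
    | ⟨k + 1, j⟩ => i k (φ k (Finsupp.single j 1))
  let E : I → M := fun t => match t with
    | ⟨0, j⟩ => ε₀ (Finsupp.single j 1)
    | ⟨_ + 1, _⟩ => 0
  let d : Module.End B (I →₀ B) := Finsupp.linearCombination B D
  let ε : (I →₀ B) →ₗ[B] M := Finsupp.linearCombination B E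
  have d_single : ∀ t, d (Finsupp.single t 1) = D t := fun t => by
    simp [d, Finsupp.linearCombination_single]
  have hd0 : ∀ w, d (i 0 w) = 0 := by
    intro w
    refine LinearMap.congr_fun (f := d ∘ₗ i 0) (g := 0) (Finsupp.lhom_ext' fun j => ?_) w
    refine LinearMap.ext_ring ?_
    simp [d, i, D, s]
  have hd1 : ∀ k w, d (i (k + 1) w) = i k (φ k w) := by
    intro k w
    refine LinearMap.congr_fun (f := d ∘ₗ i (k + 1)) (g := i k ∘ₗ φ k)
      (Finsupp.lhom_ext' fun j => ?_) w
    refine LinearMap.ext_ring ?_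
    simp [d, i, D, s]
  have hE : ∀ w, ε (i 0 w) = ε₀ w := by
    intro w
    refine LinearMap.congr_fun (f := ε ∘ₗ i 0) (g := ε₀) (Finsupp.lhom_ext' fun j => ?_) w
    refine LinearMap.ext_ring ?_
    simp [ε, i, E, s]
  have i_single : ∀ k j, Finsupp.single (⟨k, j⟩ : I) (1 : B) = i k (Finsupp.single j 1) := by
    intro k j
    simp [i, s]
  have h1' : ∀ k w, φ k (φ (k + 1) w) = 0 := fun k w => by
    rw [← LinearMap.mem_ker, ← h1]; exact ⟨w, rfl⟩
  refine ⟨I, Sigma.fst, d, ε, ?_, ?_, ?_, ?_, ?_, ?_, ?_⟩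
  · intro n
    refine Finite.of_surjective (fun j : Fin (r n) => (⟨⟨n, j⟩, rfl⟩ : {t : I // t.1 = n})) ?_
    rintro ⟨⟨_, j⟩, rfl⟩
    exact ⟨j, rfl⟩
  · rintro ⟨k, j⟩
    rw [d_single]
    cases k with
    | zero => exact Submodule.zero_mem _
    | succ k =>
      refine Finsupp.supported_mono (fun t ht => ?_) (mem_i k (φ k (Finsupp.single j 1)))
      have : (t.1 : ℤ) = k := ht
      change t.1 + 1 = k + 1
      omega
  · refine Finsupp.lhom_ext' fun t => LinearMap.ext_ring ?_
    obtain ⟨k, j⟩ := t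
    change d (d (Finsupp.single _ 1)) = 0
    rw [i_single]
    rcases k with _ | _ | k
    · rw [hd0, map_zero]
    · rw [hd1, hd0]
    · rw [hd1, hd1, h1', map_zero]
  · intro v hv
    obtain ⟨w, rfl⟩ := ex_i 1 1 (by simp) v hv
    rw [hd1, hE, ← LinearMap.mem_ker, ← h0]
    exact ⟨w, rfl⟩
  · intro m
    obtain ⟨w, rfl⟩ := hε₀ m
    exact ⟨i 0 w, mem_i 0 w, hE w⟩
  · intro n v hv hdv
    obtain ⟨w, rfl⟩ := ex_i (n + 1) (n + 1) (by push_cast; rfl) v hv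
    rw [hd1] at hdv
    have : w ∈ LinearMap.ker (φ n) := hi n (hdv.trans (map_zero _).symm)
    rw [← h1] at this
    obtain ⟨y, rfl⟩ := this
    exact ⟨i (n + 2) y, mem_homogeneousPart_of_eq (mem_i _ y) (by push_cast; ring), hd1 _ y⟩
  · intro v hv hεv
    obtain ⟨w, rfl⟩ := ex_i 0 0 (by simp) v hv
    have : w ∈ LinearMap.ker ε₀ := by rw [LinearMap.mem_ker, ← hE]; exact hεv
    rw [← h0] at this
    obtain ⟨y, rfl⟩ := this
    exact ⟨i 1 y, mem_homogeneousPart_of_eq (mem_i _ y) (by simp), hd1 0 y⟩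

end GradedResolution

/-! ### Lifting matrices from Q/(f) to Q. -/

section Lift

variable {Q I : Type*} [CommRing Q] {f : Q}

variable (f I) in
/-- Reduction modulo `f` of vectors with entries in `Q`. -/
noncomputable def reduceVec : (I →₀ Q) →ₗ[Q] (I →₀ Q ⧸ Ideal.span {f}) :=
  Finsupp.mapRange.linearMap (Ideal.Quotient.mkₐ Q (Ideal.span {f})).toLinearMap

theorem reduceVec_apply (v : I →₀ Q) (t : I) :
    reduceVec I f v t = Ideal.Quotient.mk (Ideal.span {f}) (v t) := rfl

theorem reduceVec_single (s : I) (c : Q) :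
    reduceVec I f (Finsupp.single s c) = Finsupp.single s (Ideal.Quotient.mk (Ideal.span {f}) c) :=
  Finsupp.mapRange_single (hf := map_zero _)

theorem reduceVec_smul_self (v : I →₀ Q) : reduceVec I f (f • v) = 0 := by
  ext t
  rw [reduceVec_apply, Finsupp.smul_apply, Finsupp.zero_apply, Ideal.Quotient.eq_zero_iff_mem]
  exact Ideal.mul_mem_right _ _ (Ideal.mem_span_singleton_self f)

theorem exists_reduceVec_eq {S : Set I} {v : I →₀ Q ⧸ Ideal.span {f}}
    (hv : v ∈ Finsupp.supported _ (Q ⧸ Ideal.span {f}) S) :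
    ∃ w ∈ Finsupp.supported Q Q S, reduceVec I f w = v := by
  classical
  obtain ⟨σ, hσ⟩ := (Ideal.Quotient.mk_surjective (I := Ideal.span {f})).hasRightInverse
  -- The set-theoretic section is forced to send 0 to 0, so that lifting preserves supports.
  have h0 : (Function.update σ 0 0) 0 = 0 := Function.update_self _ _ _
  refine ⟨v.mapRange (Function.update σ 0 0) h0, (Finsupp.mem_supported' _ _).2 fun t ht => ?_, ?_⟩
  · rw [Finsupp.mapRange_apply, (Finsupp.mem_supported' _ _).1 hv t ht, h0]
  · ext t
    rw [reduceVec_apply, Finsupp.mapRange_apply]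
    by_cases h : v t = 0
    · rw [h, h0, map_zero]
    · rw [Function.update_of_ne h, hσ]

theorem exists_eq_smul_of_reduceVec_eq_zero {S : Set I} {v : I →₀ Q}
    (hv : v ∈ Finsupp.supported Q Q S) (h : reduceVec I f v = 0) :
    ∃ w ∈ Finsupp.supported Q Q S, v = f • w :=
  Finsupp.exists_eq_smul_of_forall hv fun t => by
    have := DFunLike.congr_fun h t
    rw [reduceVec_apply, Finsupp.zero_apply, Ideal.Quotient.eq_zero_iff_mem,
      Ideal.mem_span_singleton'] at this
    obtain ⟨e, he⟩ := this
    exact ⟨e, by rw [← he, mul_comm]⟩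

theorem reduceVec_mem_supported {S : Set I} {v : I →₀ Q} (hv : v ∈ Finsupp.supported Q Q S) :
    reduceVec I f v ∈ Finsupp.supported _ (Q ⧸ Ideal.span {f}) S :=
  (Finsupp.mem_supported' _ _).2 fun t ht => by
    rw [reduceVec_apply, (Finsupp.mem_supported' _ _).1 hv t ht, map_zero]

theorem exists_homogeneousPart_reduceVec_eq {deg : I → ℕ} {n : ℤ} {v : I →₀ Q ⧸ Ideal.span {f}}
    (hv : v ∈ homogeneousPart (Q ⧸ Ideal.span {f}) (Q ⧸ Ideal.span {f}) deg n) :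
    ∃ w ∈ homogeneousPart Q Q deg n, reduceVec I f w = v :=
  exists_reduceVec_eq hv

theorem reduceVec_mem_homogeneousPart {deg : I → ℕ} {n : ℤ} {v : I →₀ Q}
    (hv : v ∈ homogeneousPart Q Q deg n) :
    reduceVec I f v ∈ homogeneousPart (Q ⧸ Ideal.span {f}) (Q ⧸ Ideal.span {f}) deg n :=
  reduceVec_mem_supported hv

theorem exists_eq_add_smul_of_reduceVec_eq {deg : I → ℕ} {n : ℤ} {v w : I →₀ Q}
    (hv : v ∈ homogeneousPart Q Q deg n) (hw : w ∈ homogeneousPart Q Q deg n)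
    (h : reduceVec I f w = reduceVec I f v) :
    ∃ w' ∈ homogeneousPart Q Q deg n, v = w + f • w' := by
  obtain ⟨w', hw', e⟩ := exists_eq_smul_of_reduceVec_eq_zero (f := f) (Submodule.sub_mem _ hv hw)
    (by rw [map_sub, h, sub_self])
  exact ⟨w', hw', by rw [← e, add_sub_cancel]⟩

theorem exists_lift_end {ρ : I → I → Prop}
    {h : Module.End (Q ⧸ Ideal.span {f}) (I →₀ Q ⧸ Ideal.span {f})}
    (hh : h ∈ supportedEnd _ ρ) :
    ∃ k ∈ supportedEnd Q ρ, ∀ v, reduceVec I f (k v) = h (reduceVec I f v) := by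
  choose D hDmem hD using fun s => exists_reduceVec_eq (hh s)
  refine ⟨Finsupp.linearCombination Q D, fun s => ?_, fun v => ?_⟩
  · rw [Finsupp.linearCombination_single, one_smul]
    exact hDmem s
  · refine LinearMap.congr_fun (f := reduceVec I f ∘ₗ Finsupp.linearCombination Q D)
      (g := h.restrictScalars Q ∘ₗ reduceVec I f)
      (Finsupp.lhom_ext' fun s => LinearMap.ext_ring ?_) v
    change reduceVec I f (Finsupp.linearCombination Q D (Finsupp.single s 1)) =
      h (reduceVec I f (Finsupp.single s 1))
    rw [Finsupp.linearCombination_single, one_smul, hD, reduceVec_single, map_one]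

variable {N : Type*} [AddCommGroup N] [Module Q N] [Module (Q ⧸ Ideal.span {f}) N]
  [IsScalarTower Q (Q ⧸ Ideal.span {f}) N]

/-- Matrix entries act on N only through their classes modulo f, so the choice of lift does not
matter. -/
theorem coeffEnd_eq_of_lift {h : Module.End (Q ⧸ Ideal.span {f}) (I →₀ Q ⧸ Ideal.span {f})}
    {k : Module.End Q (I →₀ Q)} (hk : ∀ v, reduceVec I f (k v) = h (reduceVec I f v))
    (v : I →₀ N) : coeffEnd N k v = coeffEnd N h v := by
  refine DFunLike.congr_fun (f := (coeffEnd N k).toAddMonoidHom)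
    (g := (coeffEnd N h).toAddMonoidHom) (Finsupp.addHom_ext fun s x => ?_) v
  change coeffEnd N k (Finsupp.single s x) = coeffEnd N h (Finsupp.single s x)
  have h1 := coeffEnd_freeTensorEquiv_tmul k (Finsupp.single s 1) x
  have h2 := coeffEnd_freeTensorEquiv_tmul h (Finsupp.single s 1) x
  rw [freeTensorEquiv_single_tmul] at h1 h2
  rw [h1, h2]
  ext t
  have h3 := hk (Finsupp.single s 1)
  rw [reduceVec_single, map_one] at h3
  rw [freeTensorEquiv_tmul_apply, freeTensorEquiv_tmul_apply, ← h3, reduceVec_apply,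
    ← Ideal.Quotient.algebraMap_eq, algebraMap_smul]

theorem relLength_restrictScalars {R V : Type*} [CommRing R] [Algebra Q R] [AddCommGroup V]
    [Module Q V] [Module R V] [IsScalarTower Q R V] (hR : Function.Surjective (algebraMap Q R))
    (K J : Submodule R V) :
    relLength (K.restrictScalars Q) (J.restrictScalars Q) = relLength K J :=
  (LinearEquiv.length_eq (Submodule.Quotient.restrictScalarsEquiv Q (J.comap K.subtype))).trans
    (Module.length_eq_of_surjective hR)

theorem homogeneousLength_eq_of_lift {deg : I → ℕ}
    {h : Module.End (Q ⧸ Ideal.span {f}) (I →₀ Q ⧸ Ideal.span {f})}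
    {k : Module.End Q (I →₀ Q)} (hk : ∀ v, reduceVec I f (k v) = h (reduceVec I f v)) (n : ℤ) :
    homogeneousLength deg (coeffEnd N h) n = homogeneousLength deg (coeffEnd N k) n := by
  rw [homogeneousLength, ← relLength_restrictScalars (Q := Q) Ideal.Quotient.mk_surjective,
    homogeneousLength]
  congr 1
  · ext v
    change v ∈ homogeneousPart (Q ⧸ Ideal.span {f}) N deg n ∧ coeffEnd N h v = 0 ↔
      v ∈ homogeneousPart Q N deg n ∧ coeffEnd N k v = 0
    rw [coeffEnd_eq_of_lift hk]
    rfl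
  · ext v
    change (∃ w ∈ homogeneousPart (Q ⧸ Ideal.span {f}) N deg (n + 1), coeffEnd N h w = v) ↔
      ∃ w ∈ homogeneousPart Q N deg (n + 1), coeffEnd N k w = v
    simp only [coeffEnd_eq_of_lift hk]
    rfl

end Lift

/-! ### Mutual bounds between the Tor lengths. -/

section Comparison

variable {Q : Type u} [CommRing Q] {f g : Q}
  (M N : Type u) [AddCommGroup M] [Module Q M] [Module (Q ⧸ Ideal.span {f}) M]
  [IsScalarTower Q (Q ⧸ Ideal.span {f}) M] [Module.Finite (Q ⧸ Ideal.span {f}) M]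
  [AddCommGroup N] [Module Q N] [Module (Q ⧸ Ideal.span {f}) N]
  [IsScalarTower Q (Q ⧸ Ideal.span {f}) N]

theorem smul_eq_zero_of_isScalarTower_quotient (x : N) : f • x = 0 := by
  rw [← algebraMap_smul (Q ⧸ Ideal.span {f}) f x, Ideal.Quotient.algebraMap_eq,
    Ideal.Quotient.eq_zero_iff_mem.2 (Ideal.mem_span_singleton_self f), zero_smul]

/-- The lengths of `Tor` over `Q` and over `Q ⧸ (f)` bound each other. -/
theorem torLength_le_sum [IsNoetherianRing Q] (hunit : ∀ n : ℕ, n ≠ 0 → IsUnit (n : Q))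
    (hfg : f * g = 0)
    (hf : ∀ c : Q, f * c = 0 → ∃ e, c = g * e) (hg : ∀ c : Q, g * c = 0 → ∃ e, c = f * e)
    (hgN : ∀ x : N, g • x = 0) (n : ℕ) :
    torLength (Q ⧸ Ideal.span {f}) M N n ≤
        2 * ∑ i ∈ Finset.range (n + 1), torLength Q M N i ∧
      torLength Q M N n ≤
        2 * ∑ i ∈ Finset.range (n + 1), torLength (Q ⧸ Ideal.span {f}) M N i := by
  obtain ⟨I, deg, d', ε', -, hd', hdd', hεd', hε', hex', hexε'⟩ :=
    exists_graded_resolution (B := Q ⧸ Ideal.span {f}) (M := M)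
  have hfN := smul_eq_zero_of_isScalarTower_quotient (f := f) N
  obtain ⟨d, hd, hdr⟩ := exists_lift_end hd'
  -- The lifted differential squares to zero modulo f, so every matrix entry of its square is
  -- divisible by f.
  have hdd : ∃ b ∈ homogeneousEnd Q deg 2, d * d = -(f • b) := by
    obtain ⟨k, hk, hkd⟩ := supportedEnd_exists_eq_smul_of_forall (g := f)
      (supportedEnd_mul (τ := fun s t => deg t + 2 = deg s)
        (fun s t r (h1 : deg t + 1 = deg s) (h2 : deg r + 1 = deg t) => by omega) hd hd)
      fun s t => by
        have : reduceVec I f ((d * d) (Finsupp.single s 1)) = 0 := by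
          rw [Module.End.mul_apply, hdr, hdr, ← Module.End.mul_apply, hdd', LinearMap.zero_apply]
        obtain ⟨w, -, hw⟩ := exists_eq_smul_of_reduceVec_eq_zero (S := Set.univ)
          (by rw [Finsupp.supported_univ]; trivial) this
        exact ⟨w t, by rw [hw]; rfl⟩
    refine ⟨(-1 : Q) • k, Submodule.smul_mem _ _ hk, LinearMap.ext fun v => ?_⟩
    rw [hkd]
    change f • k v = -(f • ((-1 : Q) • k v))
    rw [neg_one_smul, smul_neg, neg_neg]
  obtain ⟨a, b, h1, h2, h3, h4⟩ := exists_twisted_differential hunit hf hg d hd hdd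
  have hT : IsTwistedDifferential deg f g d a b := ⟨hd, h1, h2, h3, h4⟩
  have hR : ∀ n : ℕ, torLength (Q ⧸ Ideal.span {f}) M N n =
      homogeneousLength deg (coeffEnd N d) n := fun n => by
    rw [torLength_eq_homogeneousLength d' hd' hdd' ε' hεd' hε' hex' hexε',
      homogeneousLength_eq_of_lift hdr]
  let ε : (I →₀ Q) →ₗ[Q] M := ε'.restrictScalars Q ∘ₗ reduceVec I f
  have hεapp : ∀ v, ε v = ε' (reduceVec I f v) := fun v => rfl
  have hdmem : ∀ m : ℤ, ∀ v ∈ homogeneousPart Q Q deg (m + 1), d v ∈ homogeneousPart Q Q deg m :=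
    fun m v hv => supportedEnd_apply_mem hd (fun s hs t ht => by
      simp only [Set.mem_ofPred_eq] at hs ⊢; omega) hv
  have hQ : ∀ n : ℕ, torLength Q M N n = twistedLength deg (coeffEnd N a) (coeffEnd N b) n := by
    refine torLength_eq_twistedLength hT hunit hfg hf hg hfN hgN ε ?_ ?_ ?_ ?_ ?_
    · intro v
      rw [hεapp, reduceVec_smul_self, map_zero]
    · intro v hv
      rw [hεapp, hdr]
      exact hεd' _ (reduceVec_mem_homogeneousPart hv)
    · intro m
      obtain ⟨v, hv, rfl⟩ := hε' m
      obtain ⟨w, hw, rfl⟩ := exists_homogeneousPart_reduceVec_eq hv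
      exact ⟨w, hw, rfl⟩
    · rintro n v hv ⟨w, hw⟩
      obtain ⟨y, hy, hyv⟩ := hex' n _ (reduceVec_mem_homogeneousPart hv)
        (by rw [← hdr, hw, reduceVec_smul_self])
      obtain ⟨z, hz, rfl⟩ := exists_homogeneousPart_reduceVec_eq hy
      exact ⟨z, hz, exists_eq_add_smul_of_reduceVec_eq hv
        (hdmem (n + 1) z (mem_homogeneousPart_of_eq hz (by ring))) ((hdr z).trans hyv)⟩
    · intro v hv hεv
      obtain ⟨y, hy, hyv⟩ := hexε' _ (reduceVec_mem_homogeneousPart hv) hεv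
      obtain ⟨z, hz, rfl⟩ := exists_homogeneousPart_reduceVec_eq hy
      exact ⟨z, hz, exists_eq_add_smul_of_reduceVec_eq hv
        (hdmem 0 z (mem_homogeneousPart_of_eq hz (by ring))) ((hdr z).trans hyv)⟩
  have hP := hT.isTwistedPair hfN hgN
  simp only [hR, hQ]
  exact ⟨hP.homogeneousLength_le_sum n, hP.twistedLength_le_sum n⟩

end Comparison

/-! ### Supports, annihilators and finite length. -/

section FiniteLength

variable {A : Type*} [CommRing A]

/-- Evaluation on finitely many generators embeds a quotient of A into a power of L. That quotient
is Artinian and surjects onto the domain A/p, which is thus a field. -/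
theorem isMaximal_of_annihilator_le {L : Type*} [AddCommGroup L] [Module A L] [Module.Finite A L]
    [IsArtinian A L] {p : Ideal A} [p.IsPrime] (h : Module.annihilator A L ≤ p) : p.IsMaximal := by
  obtain ⟨s, hs⟩ := Module.Finite.fg_top (R := A) (M := L)
  let φ : A →ₗ[A] (s → L) := LinearMap.pi fun x => LinearMap.toSpanSingleton A L x
  have hφ : LinearMap.ker φ ≤ p := fun r hr => h <| Module.mem_annihilator.2 fun x => by
    have hx : x ∈ Submodule.span A (s : Set L) := hs ▸ Submodule.mem_top
    induction hx using Submodule.span_induction with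
    | mem y hy => exact congrFun hr ⟨y, hy⟩
    | zero => exact smul_zero r
    | add y z _ _ hy hz => rw [smul_add, hy, hz, add_zero]
    | smul c y _ hy => rw [smul_comm, hy, smul_zero]
  have h1 : IsArtinian A (A ⧸ LinearMap.ker φ) :=
    isArtinian_of_injective ((LinearMap.ker φ).liftQ φ le_rfl)
      (LinearMap.ker_eq_bot.1 (Submodule.ker_liftQ_eq_bot' _ _ rfl))
  have h2 : IsArtinian A (A ⧸ p) :=
    isArtinian_of_surjective _ (Submodule.factor hφ) (Submodule.factor_surjective hφ)
  have h3 : IsArtinianRing (A ⧸ p) := isArtinian_of_tower A h2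
  exact Ideal.Quotient.maximal_of_isField p (IsArtinianRing.isField_of_isDomain _)

/-- For finite modules the support of a tensor product is the intersection of the supports: after
base change to the residue field at p, a tensor product of nonzero vector spaces is nonzero. -/
theorem annihilator_tensorProduct_le_of_isPrime {M N : Type*} [AddCommGroup M] [Module A M]
    [AddCommGroup N] [Module A N] [Module.Finite A M] [Module.Finite A N] {p : Ideal A}
    [hp : p.IsPrime] (hM : Module.annihilator A M ≤ p) (hN : Module.annihilator A N ≤ p) :
    Module.annihilator A (M ⊗[A] N) ≤ p := by
  let P : PrimeSpectrum A := ⟨p, hp⟩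
  have hM' : P ∈ Module.support A M := Module.mem_support_iff_of_finite.2 hM
  have hN' : P ∈ Module.support A N := Module.mem_support_iff_of_finite.2 hN
  refine (Module.mem_support_iff_of_finite (p := P)).1 ?_
  rw [Module.mem_support_iff_nontrivial_residueField_tensorProduct] at hM' hN' ⊢
  exact (TensorProduct.AlgebraTensorModule.distribBaseChange A P.asIdeal.ResidueField
    M N).toEquiv.nontrivial

/-- Every prime over both annihilators lies in the support of M ⊗ N and is therefore maximal, so the
Noetherian quotient has dimension zero. -/
theorem isArtinianRing_quotient_annihilator_sup [IsNoetherianRing A] {M N : Type*}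
    [AddCommGroup M] [Module A M] [AddCommGroup N] [Module A N] [Module.Finite A M]
    [Module.Finite A N] [IsArtinian A (M ⊗[A] N)] :
    IsArtinianRing (A ⧸ Module.annihilator A M ⊔ Module.annihilator A N) := by
  refine isArtinianRing_iff_isNoetherianRing_krullDimLE_zero.2 ⟨inferInstance,
    Ring.KrullDimLE.mk₀ fun J hJ => ?_⟩
  let p := J.comap (Ideal.Quotient.mk _)
  have hprime : p.IsPrime := Ideal.comap_isPrime _ _
  have hp : Module.annihilator A M ⊔ Module.annihilator A N ≤ p := fun x hx => by
    rw [Ideal.mem_comap, Ideal.Quotient.eq_zero_iff_mem.2 hx]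
    exact J.zero_mem
  have hmax : p.IsMaximal := isMaximal_of_annihilator_le <|
    annihilator_tensorProduct_le_of_isPrime (le_sup_left.trans hp) (le_sup_right.trans hp)
  have hmap := Ideal.map_comap_of_surjective _ (Ideal.Quotient.mk_surjective) J
  rw [← hmap]
  exact (Ideal.map_eq_top_or_isMaximal_of_surjective _ Ideal.Quotient.mk_surjective
    hmax).resolve_left fun h => hJ.ne_top (hmap.symm.trans h)

theorem length_ne_top_of_annihilator_le {X : Type*} [AddCommGroup X] [Module A X]
    [Module.Finite A X] {𝔞 : Ideal A} [IsArtinianRing (A ⧸ 𝔞)] (h : ∀ r ∈ 𝔞, ∀ x : X, r • x = 0) :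
    Module.length A X ≠ ⊤ := by
  let _ : Module (A ⧸ 𝔞) X := Module.IsTorsionBySet.module (I := 𝔞) fun x r => h r r.2 x
  have : IsScalarTower A (A ⧸ 𝔞) X := ⟨fun r s x => by
    obtain ⟨s, rfl⟩ := Ideal.Quotient.mk_surjective s
    exact mul_smul r s x⟩
  have : Module.Finite (A ⧸ 𝔞) X := Module.Finite.of_restrictScalars_finite A _ _
  rw [Module.length_eq_of_surjective (R := A ⧸ 𝔞) Ideal.Quotient.mk_surjective]
  exact Module.length_ne_top

end FiniteLength

/-! ### Null-homotopies for annihilating scalars. -/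

section Homotopy

variable {A I M : Type*} [CommRing A] [AddCommGroup M] [Module A M] {deg : I → ℕ}
  {d : Module.End A (I →₀ A)}

/-- Multiplication by r lifts the zero map of M, so it is null-homotopic on the resolution. The map
`c n` starts in degree n - 1, which makes its condition depend only on earlier maps and vacuously
true at n = 0. -/
theorem exists_homotopy (hd : d ∈ homogeneousEnd A deg 1) (hdd : d * d = 0) (ε : (I →₀ A) →ₗ[A] M)
    (hex : ∀ n : ℕ, ∀ v ∈ homogeneousPart A A deg (n + 1), d v = 0 →
      ∃ w ∈ homogeneousPart A A deg (n + 2), d w = v)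
    (hexε : ∀ v ∈ homogeneousPart A A deg 0, ε v = 0 → ∃ w ∈ homogeneousPart A A deg 1, d w = v)
    {r : A} (hr : ∀ m : M, r • m = 0) :
    ∃ c : ℕ → Module.End A (I →₀ A), ∀ n : ℕ, ∀ v ∈ homogeneousPart A A deg (n - 1),
      c n v ∈ homogeneousPart A A deg n ∧ d (c n v) + c (n - 1) (d v) = r • v := by
  have hneg : ∀ n : ℤ, n < 0 → ∀ v ∈ homogeneousPart A A deg n, v = 0 := fun n hn v hv =>
    eq_zero_of_mem_alternatePart hn (homogeneousPart_le_alternatePart _ hv)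
  have hdmem : ∀ n : ℤ, ∀ v ∈ homogeneousPart A A deg n, d v ∈ homogeneousPart A A deg (n - 1) :=
    fun n v hv => supportedEnd_apply_mem hd (fun s hs t ht => by
      simp only [Set.mem_ofPred_eq] at hs ⊢; omega) hv
  refine exists_seq_of_exists_update (fun (c : ℕ → Module.End A (I →₀ A)) n =>
    ∀ v ∈ homogeneousPart A A deg (n - 1),
      c n v ∈ homogeneousPart A A deg n ∧ d (c n v) + c (n - 1) (d v) = r • v) ?_ ?_
  · intro c c' n h hc v hv
    rw [← h n le_rfl, ← h (n - 1) (Nat.sub_le _ _)]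
    exact hc v hv
  · intro c n hc
    rcases n with _ | k
    · refine ⟨0, fun v hv => ?_⟩
      obtain rfl := hneg _ (by simp) v hv
      simp
    have hc' := hc k k.lt_succ_self
    have key : ∀ s, ∃ w ∈ homogeneousPart A A deg (k + 1 : ℕ), deg s = k →
        d w + c k (d (Finsupp.single s 1)) = r • Finsupp.single s 1 := by
      intro s
      by_cases hs : deg s = k
      swap
      · exact ⟨0, Submodule.zero_mem _, fun h => absurd h hs⟩
      have hs' : (Finsupp.single s 1 : I →₀ A) ∈ homogeneousPart A A deg k :=
        Finsupp.single_mem_supported A _ (by simp [hs])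
      have hck := hc' _ (hdmem _ _ hs')
      have hmem : r • Finsupp.single s 1 - c k (d (Finsupp.single s 1)) ∈
          homogeneousPart A A deg k := Submodule.sub_mem _ (Submodule.smul_mem _ _ hs') hck.1
      have hz : d (r • Finsupp.single s 1 - c k (d (Finsupp.single s 1))) = 0 := by
        have : d (d (Finsupp.single s 1)) = 0 := LinearMap.congr_fun hdd _
        have h2 := hck.2
        rw [this, map_zero, add_zero] at h2
        rw [map_sub, h2, map_smul, sub_self]
      obtain ⟨w, hw, e⟩ : ∃ w ∈ homogeneousPart A A deg (k + 1 : ℕ),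
          d w = r • Finsupp.single s 1 - c k (d (Finsupp.single s 1)) := by
        rcases k with _ | j
        · have h0 : d (Finsupp.single s 1) = 0 := hneg _ (by simp) _ (hdmem _ _ hs')
          obtain ⟨w, hw, e⟩ := hexε (r • Finsupp.single s 1 - c 0 (d (Finsupp.single s 1)))
            (mem_homogeneousPart_of_eq hmem Nat.cast_zero)
            (by rw [h0, map_zero, sub_zero, map_smul, hr])
          exact ⟨w, mem_homogeneousPart_of_eq hw (by simp), e⟩
        · obtain ⟨w, hw, e⟩ := hex j _ (mem_homogeneousPart_of_eq hmem (by push_cast; ring)) hz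
          exact ⟨w, mem_homogeneousPart_of_eq hw (by push_cast; ring), e⟩
      exact ⟨w, hw, fun _ => by rw [e, sub_add_cancel]⟩
    choose W hWmem hW using key
    refine ⟨Finsupp.linearCombination A W, fun v hv => ?_⟩
    rw [Function.update_self, Function.update_of_ne (by omega), Nat.add_sub_cancel]
    refine ⟨?_, ?_⟩
    · rw [Finsupp.linearCombination_apply]
      exact Submodule.sum_mem _ fun s _ => Submodule.smul_mem _ _ (hWmem s)
    · rw [← LinearMap.comp_apply, ← LinearMap.comp_apply, ← LinearMap.add_apply,
        ← LinearMap.lsmul_apply]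
      have hsupp := (Finsupp.mem_supported _ _).1 hv
      rw [← v.sum_single, Finsupp.sum, map_sum, map_sum]
      refine Finset.sum_congr rfl fun s hs => ?_
      have hs' : deg s = k := by
        have := hsupp hs
        simp only [Set.mem_ofPred_eq] at this
        omega
      rw [← mul_one (v s), ← smul_eq_mul, ← Finsupp.smul_single, map_smul, map_smul]
      congr 1
      simpa using hW s hs'

end Homotopy

/-! ### Finiteness of Tor lengths. -/

section Finiteness

/-- Tor is finitely generated and killed by both annihilators, of M by homotopy and of N entrywise.
It is thus a finite module over an Artinian quotient of A. -/
theorem torLength_ne_top {A : Type u} [CommRing A] [IsNoetherianRing A] (M N : Type u)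
    [AddCommGroup M] [Module A M] [Module.Finite A M] [AddCommGroup N] [Module A N]
    [Module.Finite A N] (hMN : Module.length A (M ⊗[A] N) ≠ ⊤) (n : ℕ) :
    torLength A M N n ≠ ⊤ := by
  obtain ⟨I, deg, d, ε, hfin, hd, hdd, hεd, hε, hex, hexε⟩ :=
    exists_graded_resolution (B := A) (M := M)
  rw [torLength_eq_homogeneousLength d hd hdd ε hεd hε hex hexε, homogeneousLength, relLength]
  have hart : IsArtinian A (M ⊗[A] N) :=
    (isFiniteLength_iff_isNoetherian_isArtinian.1 (Module.length_ne_top_iff.1 hMN)).2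
  have := isArtinianRing_quotient_annihilator_sup (A := A) (M := M) (N := N)
  have hfin' : Finite {t | (deg t : ℤ) = n} := by
    have := hfin n
    exact Finite.of_injective (fun t => (⟨t.1, by exact_mod_cast t.2⟩ : {t // deg t = n}))
      fun s t h => Subtype.ext (congrArg (fun x : {t // deg t = n} => x.1) h)
  have : IsNoetherian A ({t | (deg t : ℤ) = n} →₀ N) :=
    isNoetherian_of_linearEquiv (Finsupp.linearEquivFunOnFinite A N _).symm
  have : IsNoetherian A (homogeneousPart A N deg n) :=
    isNoetherian_of_linearEquiv (Finsupp.supportedEquivFinsupp _).symm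
  have : IsNoetherian A ↥(homogeneousPart A N deg n ⊓ LinearMap.ker (coeffEnd N d)) :=
    isNoetherian_of_le inf_le_left
  refine length_ne_top_of_annihilator_le (𝔞 := Module.annihilator A M ⊔ Module.annihilator A N)
    fun r hr => ?_
  suffices h : Module.annihilator A M ⊔ Module.annihilator A N ≤ Module.annihilator A
      (↥(homogeneousPart A N deg n ⊓ LinearMap.ker (coeffEnd N d)) ⧸
        ((homogeneousPart A N deg (n + 1)).map (coeffEnd N d)).comap
          (homogeneousPart A N deg n ⊓ LinearMap.ker (coeffEnd N d)).subtype) from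
    Module.mem_annihilator.1 (h hr)
  refine sup_le (fun r hr => ?_) fun r hr => ?_ <;> rw [Module.mem_annihilator] at hr ⊢ <;>
    refine fun x => Submodule.Quotient.induction_on _ x fun ⟨v, hv, hdv⟩ => ?_
  · obtain ⟨c, hc⟩ := exists_homotopy hd hdd ε hex hexε hr
    rw [← Submodule.Quotient.mk_smul, Submodule.Quotient.mk_eq_zero]
    have hmem : coeffEnd N (c (n + 1)) v ∈ homogeneousPart A N deg (n + 1) := by
      -- The homotopy is controlled only on degree n, so the support relation imposes nothing on
      -- other basis vectors.
      refine coeffEnd_apply_mem (ρ := fun s t => deg s = n → deg t = n + 1) (fun s => ?_)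
        (fun s hs t ht => ?_) hv
      · by_cases hs : deg s = n
        · refine Finsupp.supported_mono (fun t ht _ => ?_) (hc (n + 1) (Finsupp.single s 1)
            (Finsupp.single_mem_supported A _ (by simp [hs]))).1
          simp only [Set.mem_ofPred_eq] at ht
          omega
        · exact (Finsupp.mem_supported _ _).2 fun t _ h => absurd h hs
      · simp only [Set.mem_ofPred_eq] at hs ⊢
        have := ht (by omega)
        omega
    refine ⟨coeffEnd N (c (n + 1)) v, hmem, ?_⟩
    -- The homotopy identity is carried over to N through one matrix all of whose columns in degree
    -- n vanish.
    have hzero : coeffEnd N (d * c (n + 1) + c n * d + (-r) • 1) v = 0 := by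
      have := coeffEnd_apply_mem (N := N) (h := d * c (n + 1) + c n * d + (-r) • 1)
        (ρ := fun s t => deg s ≠ n) (S := {t | (deg t : ℤ) = n}) (T := ∅) (fun s => ?_)
        (fun s hs t ht => ht (by simp only [Set.mem_ofPred_eq] at hs; omega)) hv
      · rwa [Finsupp.supported_empty, Submodule.mem_bot] at this
      · by_cases hs : deg s = n
        · have h2 := (hc (n + 1) (Finsupp.single s 1)
            (Finsupp.single_mem_supported A _ (by simp [hs]))).2
          rw [Nat.add_sub_cancel] at h2
          have : (d * c (n + 1) + c n * d + (-r) • 1 : Module.End A (I →₀ A))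
              (Finsupp.single s 1) = 0 := by
            change d (c (n + 1) (Finsupp.single s 1)) + c n (d (Finsupp.single s 1)) +
              (-r) • Finsupp.single s 1 = 0
            rw [h2, neg_smul, add_neg_cancel]
          rw [this]
          exact Submodule.zero_mem _
        · exact (Finsupp.mem_supported _ _).2 fun t _ => hs
    rw [map_add, map_add, map_mul, map_mul, map_smul, map_one] at hzero
    change coeffEnd N d (coeffEnd N (c (n + 1)) v) + coeffEnd N (c n) (coeffEnd N d v) +
      (-r) • v = 0 at hzero
    rwa [LinearMap.mem_ker.1 hdv, map_zero, add_zero, neg_smul, add_neg_eq_zero] at hzero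
  · rw [← Submodule.Quotient.mk_smul]
    exact (congrArg _ (Subtype.ext (Finsupp.ext fun t => hr (v t)))).trans
      (Submodule.Quotient.mk_zero _)

end Finiteness

/-! ### Growth rates under partial sums. -/

section Curvature

open Filter

theorem eventually_linear_le_pow (B : ℝ) {r : ℝ} (hr : 1 < r) :
    ∀ᶠ n : ℕ in atTop, 2 * (B + (n + 1)) ≤ r ^ n := by
  have h0 := tendsto_pow_const_div_const_pow_of_one_lt 0 hr
  have h1 := tendsto_pow_const_div_const_pow_of_one_lt 1 hr
  have h := ((h0.const_mul (2 * (B + 1))).add (h1.const_mul 2)).eventually_lt_const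
    (u := 1) (by norm_num)
  filter_upwards [h] with n hn
  have hpos : 0 < r ^ n := by positivity
  rw [pow_zero, pow_one, mul_div_assoc', mul_div_assoc', ← add_div, div_lt_one hpos] at hn
  linarith

/-- For c > c' > max(1, limsup), eventually b i ≤ c'ⁱ ≤ c'ⁿ when i ≤ n, so a n is at most 2(B + n +
1)c'ⁿ with B finite. The linear factor is absorbed by (c/c')ⁿ. -/
theorem limsup_rpow_le_of_le_sum {a b : ℕ → ℝ≥0∞} (hb : ∀ n, b n ≠ ⊤)
    (h : ∀ n, a n ≤ 2 * ∑ i ∈ Finset.range (n + 1), b i) :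
    limsup (fun n : ℕ => a n ^ (1 / (n : ℝ))) atTop ≤
      max 1 (limsup (fun n : ℕ => b n ^ (1 / (n : ℝ))) atTop) := by
  refine le_of_forall_gt_imp_ge_of_dense fun c hc => ?_
  rcases eq_or_ne c ⊤ with rfl | hctop
  · exact le_top
  obtain ⟨c', hc', hcc'⟩ := exists_between hc
  lift c to NNReal using hctop
  lift c' to NNReal using hcc'.ne_top
  have hc1 : 1 ≤ c' := by exact_mod_cast (le_max_left _ _).trans hc'.le
  rw [ENNReal.coe_lt_coe] at hcc'
  have hev := eventually_lt_of_limsup_lt ((le_max_right _ _).trans_lt hc')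
  obtain ⟨n₀, hn₀⟩ := eventually_atTop.1 hev
  -- At n = 0 the exponent 1/n is 0 by convention, and the root bound says nothing about b 0.
  have hbn : ∀ n, n₀ ≤ n → b n ≤ (c' : ℝ≥0∞) ^ n ∨ n = 0 := by
    intro n hn
    rcases eq_or_ne n 0 with rfl | h0
    · exact Or.inr rfl
    refine Or.inl ?_
    have := (hn₀ n hn).le
    rwa [one_div, ENNReal.rpow_inv_le_iff (by positivity), ENNReal.rpow_natCast] at this
  obtain ⟨B, hB⟩ : ∃ B : NNReal, (B : ℝ≥0∞) = ∑ i ∈ Finset.range (n₀ + 1), b i :=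
    ENNReal.canLift.prf _ (ENNReal.sum_ne_top.2 fun i _ => hb i)
  have hle : ∀ n, a n ≤ ((2 * (B + (n + 1)) * c' ^ n : NNReal) : ℝ≥0∞) := by
    intro n
    have hsum : ∑ i ∈ Finset.range (n + 1), b i ≤
        ∑ i ∈ Finset.range (n₀ + 1), b i + ∑ i ∈ Finset.range (n + 1), (c' : ℝ≥0∞) ^ n := by
      rw [← Finset.sum_filter_add_sum_filter_not (Finset.range (n + 1)) (· ≤ n₀)]
      refine add_le_add (Finset.sum_le_sum_of_subset fun i hi => ?_)
        ((Finset.sum_le_sum fun i hi => ?_).trans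
          (Finset.sum_le_sum_of_subset (Finset.filter_subset _ _)))
      · rw [Finset.mem_filter] at hi
        rw [Finset.mem_range]
        omega
      · rw [Finset.mem_filter, Finset.mem_range] at hi
        refine ((hbn i (by omega)).resolve_right (by omega)).trans ?_
        exact pow_le_pow_right₀ (by exact_mod_cast hc1) (by omega)
    refine (h n).trans ((mul_le_mul_right hsum 2).trans ?_)
    rw [← hB, Finset.sum_const, Finset.card_range, nsmul_eq_mul]
    norm_cast
    rw [mul_assoc, add_mul]
    refine mul_le_mul_right (add_le_add (le_mul_of_one_le_right' (one_le_pow₀ hc1)) ?_) 2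
    push_cast
    rfl
  have hpos : 0 < (c' : ℝ) := by positivity
  have hlin := eventually_linear_le_pow B (r := c / c') (by
    rw [one_lt_div hpos]
    exact_mod_cast hcc')
  refine limsup_le_of_le (h := ?_)
  filter_upwards [hlin, eventually_gt_atTop 0] with n hn h0
  rw [one_div, ENNReal.rpow_inv_le_iff (by positivity), ENNReal.rpow_natCast]
  refine (hle n).trans ?_
  rw [div_pow, le_div_iff₀ (by positivity)] at hn
  exact_mod_cast hn

theorem lengthCurvature_le_of_torLength_le_sum {A B : Type u} [CommRing A] [CommRing B]
    {M N : Type u} [AddCommGroup M] [Module A M] [Module B M] [AddCommGroup N] [Module A N]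
    [Module B N] (hfin : ∀ n, torLength B M N n ≠ ⊤)
    (h : ∀ n, torLength A M N n ≤ 2 * ∑ i ∈ Finset.range (n + 1), torLength B M N i) :
    lengthCurvature A M N ≤ max 1 (lengthCurvature B M N) := by
  simp only [lengthCurvature, curvature, poincareSeries, PowerSeries.coeff_mk]
  refine limsup_rpow_le_of_le_sum (fun n => by simpa using hfin n) fun n => ?_
  refine (ENat.toENNReal_le.2 (h n)).trans_eq ?_
  rw [ENat.toENNReal_mul]
  exact congrArg _ (map_sum ENat.toENNRealRingHom _ _)

end Curvature

/-! ### Exact pairs in residue characteristic 0, and the conclusion. -/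

theorem CharZero.isUnit_natCast_of_residueField {Q : Type*} [CommRing Q] [IsLocalRing Q]
    [CharZero (IsLocalRing.ResidueField Q)] {n : ℕ} (hn : n ≠ 0) : IsUnit (n : Q) := by
  rw [← IsLocalRing.residue_ne_zero_iff_isUnit, map_natCast]
  exact Nat.cast_ne_zero.2 hn

theorem exists_eq_mul_of_annihilator_eq {Q : Type*} [CommRing Q] {f g : Q}
    (h : (Ideal.span {f}).annihilator = Ideal.span {g}) {c : Q} (hc : f * c = 0) :
    ∃ e, c = g * e := by
  have : c ∈ (Ideal.span {f}).annihilator := by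
    rw [Ideal.span, Submodule.mem_annihilator_span_singleton, smul_eq_mul, mul_comm, hc]
  rw [h, Ideal.mem_span_singleton'] at this
  obtain ⟨e, rfl⟩ := this
  exact ⟨e, mul_comm _ _⟩

theorem mainTheorem4 (Q : Type u) [CommRing Q] [IsLocalRing Q] [IsNoetherianRing Q]
    [CharZero (IsLocalRing.ResidueField Q)]
    (f g : Q) (hfg : IsExactPairOfZeroDivisors f g)
    (M N : Type u)
    [AddCommGroup M] [Module Q M] [Module (Q ⧸ Ideal.span {f}) M]
    [IsScalarTower Q (Q ⧸ Ideal.span {f}) M] [Module.Finite (Q ⧸ Ideal.span {f}) M]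
    [AddCommGroup N] [Module Q N] [Module (Q ⧸ Ideal.span {f}) N]
    [IsScalarTower Q (Q ⧸ Ideal.span {f}) N] [Module.Finite (Q ⧸ Ideal.span {f}) N]
    (hgN : ∀ x : N, g • x = 0)
    (hMN : Module.length Q (M ⊗[Q] N) ≠ ⊤)
    (hQ : 1 ≤ lengthCurvature Q M N)
    (hR : 1 ≤ lengthCurvature (Q ⧸ Ideal.span {f}) M N) :
    lengthCurvature Q M N = lengthCurvature (Q ⧸ Ideal.span {f}) M N := by
  have : Module.Finite Q M := Module.Finite.trans (Q ⧸ Ideal.span {f}) M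
  have : Module.Finite Q N := Module.Finite.trans (Q ⧸ Ideal.span {f}) N
  have hfg0 : f * g = 0 := by
    have : g ∈ (Ideal.span {f}).annihilator :=
      hfg.annihilator_left ▸ Ideal.mem_span_singleton_self g
    rwa [Ideal.span, Submodule.mem_annihilator_span_singleton, smul_eq_mul, mul_comm] at this
  have hle := torLength_le_sum (f := f) M N
    (fun n hn => CharZero.isUnit_natCast_of_residueField hn) hfg0
    (fun c hc => exists_eq_mul_of_annihilator_eq hfg.annihilator_left hc)
    (fun c hc => exists_eq_mul_of_annihilator_eq hfg.annihilator_right hc) hgN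
  have hfinQ : ∀ n, torLength Q M N n ≠ ⊤ := torLength_ne_top M N hMN
  -- Finiteness over the quotient follows from finiteness over Q through the comparison bound.
  have hfinR : ∀ n, torLength (Q ⧸ Ideal.span {f}) M N n ≠ ⊤ := fun n => by
    have hsum := WithTop.sum_ne_top.2 fun i (_ : i ∈ Finset.range (n + 1)) => hfinQ i
    refine ne_top_of_le_ne_top ?_ (hle n).1
    rw [two_mul]
    exact WithTop.add_ne_top.2 ⟨hsum, hsum⟩
  refine le_antisymm ?_ ?_
  · exact (lengthCurvature_le_of_torLength_le_sum hfinR fun n => (hle n).2).trans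
      (max_le hR le_rfl)
  · exact (lengthCurvature_le_of_torLength_le_sum hfinQ fun n => (hle n).1).trans
      (max_le hQ le_rfl)
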